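/- Let $0<\lambda<1$ and $b_1,b_2,c>0$, and put $a=\sqrt{b_1^2+b_2^2}$, $\varphi=\arctan(b_2/b_1)$, $\boldsymbol a=(a,0,0)$, $\boldsymbol b=(b_1,b_2,0)$, $\boldsymbol c=\lambda\boldsymbol b+(0,0,c)$, $\boldsymbol d=\lambda\boldsymbol a-(0,0,c)$. The SCD tile is $$T=\operatorname{conv}(\boldsymbol 0,\boldsymbol a,\boldsymbol b,\boldsymbol a+\boldsymbol b,\boldsymbol c,\boldsymbol a+\boldsymbol c,\boldsymbol d,\boldsymbol b+\boldsymbol d);$$ it is called commensurate if $\varphi\in\pi\mathbb Q$ and incommensurate otherwise. Let $\Gamma=\mathbb Z\boldsymbol a+\mathbb Z\boldsymbol b$, let $\Gamma^*$ be its dual lattice in the plane $\mathbb R^2=\{x_3=0\}$, and let $R$ be the rotation through $-\varphi$ about the axis $\mathbb R\boldsymbol e_3$ (so $R\boldsymbol b=\boldsymbol a$). An SCD tiling has the layers $m(0,0,c)+\boldsymbol v_m+R^m(L-\boldsymbol c)$, $m\in\mathbb Z$, where $L=\{\boldsymbol x+T : \boldsymbol x\in\Gamma\}$, the vectors $\boldsymbol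 v_m$ are horizontal, and $\boldsymbol v_{m+1}-\boldsymbol v_m$ is a real multiple of $R^m\boldsymbol a$ for every $m$. Its SCD set with respect to an interior point $\boldsymbol z$ of $T$ is obtained by replacing each tile $\boldsymbol w+R^mT$ of the $m$-th layer by the point $\boldsymbol w+R^m\boldsymbol z$, that is, $$\Lambda=\{m(0,0,c)+\boldsymbol v_m+R^m(\boldsymbol x-\boldsymbol c)+R^m\boldsymbol z : m\in\mathbb Z,\ \boldsymbol x\in\Gamma\}.$$ Let $C_r=[-r/2,r/2]^3$, and let $\gamma$ be any autocorrelation of $\Lambda$, i.e. any locally finite measure that is the vague limit of $$r^{-3}\sum_{\boldsymbol x,\boldsymbol y\in\Lambda\cap C_r}\delta_{\boldsymbol x-\boldsymbol y}$$ along some sequence of radii $r\to\infty$. Then the Fourier transform $\widehat\gamma$ of $\gamma$, in the sense of tempered distributions, is a (unique) positive, locally finite measure on $\mathbb R^3$. It is singular with respect to Lebesgue measure (it has no absolutely continuous part), and it is supported on $$M=\operatorname{cl}\Bigl(\bigcup_{m\in\mathbb Z}R^m\Gamma^*\Bigr)\times\mathbb R ,$$ i.e. $\widehat\gamma(\mathbb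 R^3\setminus M)=0$. In the incommensurate case, $M$ is the union, over all $\boldsymbol y\in\Gamma^*$, of the cylinder surfaces $\{x_1^2+x_2^2=\|\boldsymbol y\|^2\}$ around $\mathbb R\boldsymbol e_3$ (for $\boldsymbol y=\boldsymbol 0$ this is the axis itself). In the commensurate case, $M$ is the union of the lines $R^m\boldsymbol y+\mathbb R\boldsymbol e_3$ with $m\in\mathbb Z$, $\boldsymbol y\in\Gamma^*$. -/

import Mathlib

open MeasureTheory Filter Topology Set
open scoped FourierTransform SchwartzMap

noncomputable section

/-- Euclidean three-space. -/
abbrev E3 : Type := EuclideanSpace ℝ (Fin 3)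

/-- Rotation about the axis `ℝ e₃` through the angle `θ` (counterclockwise for `θ > 0`). -/
def axisRot (θ : ℝ) (x : E3) : E3 :=
  !₂[Real.cos θ * x 0 - Real.sin θ * x 1, Real.sin θ * x 0 + Real.cos θ * x 1, x 2]

/-- The parameters of an SCD tile. -/
structure SCDTile where
  lam : ℝ
  b₁ : ℝ
  b₂ : ℝ
  c : ℝ
  lam_pos : 0 < lam
  lam_lt_one : lam < 1
  b₁_pos : 0 < b₁
  b₂_pos : 0 < b₂
  c_pos : 0 < c

namespace SCDTile

variable (P : SCDTile)

/-- The vector `𝐚 = (a, 0, 0)` with `a = √(b₁² + b₂²)`. -/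
def vecA : E3 := !₂[Real.sqrt (P.b₁ ^ 2 + P.b₂ ^ 2), 0, 0]

/-- The vector `𝐛 = (b₁, b₂, 0)`. -/
def vecB : E3 := !₂[P.b₁, P.b₂, 0]

/-- The vertical vector `(0, 0, c)`. -/
def vert : E3 := !₂[0, 0, P.c]

/-- The vector `𝐜 = λ 𝐛 + (0, 0, c)`. -/
def vecC : E3 := P.lam • P.vecB + P.vert

/-- The vector `𝐝 = λ 𝐚 - (0, 0, c)`. -/
def vecD : E3 := P.lam • P.vecA - P.vert

/-- The prototile `T`, a biprism. -/
def prototile : Set E3 :=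
  convexHull ℝ {0, P.vecA, P.vecB, P.vecA + P.vecB, P.vecC, P.vecA + P.vecC, P.vecD,
    P.vecB + P.vecD}

/-- The angle `φ ∈ (0, π/2)` between `𝐚` and `𝐛`. -/
def angle : ℝ := Real.arctan (P.b₂ / P.b₁)

/-- The tile is commensurate if `φ ∈ π ℚ`, and incommensurate otherwise. -/
def Commensurate : Prop := ∃ q : ℚ, P.angle = Real.pi * q

/-- `R ^ m`, where `R` is the rotation about `ℝ e₃` through `-φ`, so that `R 𝐛 = 𝐚`. -/
def rotPow (m : ℤ) : E3 → E3 := axisRot (m * (-P.angle))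

/-- The planar lattice `Γ = ℤ 𝐚 + ℤ 𝐛`, in the plane `x₃ = 0`. -/
def lattice : AddSubgroup E3 := AddSubgroup.closure {P.vecA, P.vecB}

/-- The dual lattice `Γ*` in the plane `x₃ = 0`. -/
def dualLattice : Set E3 :=
  {y | y 2 = 0 ∧ ∀ x ∈ P.lattice, ∃ k : ℤ, inner ℝ y x = (k : ℝ)}

/-- The set `M = cl (⋃ m, R ^ m Γ*) × ℝ`, where the closure is taken in the plane `x₃ = 0`. -/
def spectralSet : Set E3 :=
  {x | (!₂[x 0, x 1, 0] : E3) ∈ closure (⋃ m : ℤ, P.rotPow m '' P.dualLattice)}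

end SCDTile

/-- An SCD tiling, given by the horizontal displacements of its layers. The layer number `m` is
`m (0, 0, c) + v m + R ^ m (L - 𝐜)`, where `L` is the collection of the tiles `x + T`, `x ∈ Γ`.
The top of this layer has its ridges parallel to `R ^ m 𝐚 = R ^ (m + 1) 𝐛`, as has the bottom of
the next layer, and the two may be shifted against each other in this direction only. -/
structure SCDTiling (P : SCDTile) where
  v : ℤ → E3
  v_horizontal : ∀ m, v m 2 = 0
  v_step : ∀ m, ∃ t : ℝ, v (m + 1) - v m = t • P.rotPow m P.vecA

namespace SCDTiling

variable {P : SCDTile} (𝒯 : SCDTiling P)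

/-- The translation vector `w` of the tile `w + R ^ m T` that comes from `x + T` in the layer
number `m`. -/
def pos (m : ℤ) (x : E3) : E3 := (m : ℝ) • P.vert + 𝒯.v m + P.rotPow m (x - P.vecC)

/-- The tile of the layer number `m` that comes from `x + T`. -/
def tile (m : ℤ) (x : E3) : Set E3 := (fun y => 𝒯.pos m x + P.rotPow m y) '' P.prototile

/-- The collection of all tiles. -/
def tiles : Set (Set E3) := {S | ∃ m : ℤ, ∃ x ∈ P.lattice, S = 𝒯.tile m x}

/-- The SCD set: every tile `w + R ^ m T` of the layer number `m` is replaced by its reference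
point `w + R ^ m z`. -/
def pointSet (z : E3) : Set E3 :=
  {p | ∃ m : ℤ, ∃ x ∈ P.lattice, p = 𝒯.pos m x + P.rotPow m z}

end SCDTiling

/-- The closed cube `[-r/2, r/2]³`. -/
def cube (r : ℝ) : Set E3 := {x | ∀ i, |x i| ≤ r / 2}

/-- The measure `r⁻³ ∑ δ_{x - y}`, the sum over all `x, y ∈ Λ ∩ C_r`. -/
def finiteAutocorrelation (Λ : Set E3) (r : ℝ) : Measure E3 :=
  ENNReal.ofReal ((r ^ 3)⁻¹) •
    Measure.sum fun p : (Λ ∩ cube r : Set E3) × (Λ ∩ cube r : Set E3) =>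
      Measure.dirac ((p.1 : E3) - (p.2 : E3))

/-- `γ` is an autocorrelation of `Λ`: a locally finite measure that is the vague limit of
`r⁻³ ∑_{x, y ∈ Λ ∩ C_r} δ_{x - y}` along some sequence of radii that tends to infinity. -/
def IsAutocorrelation (Λ : Set E3) (γ : Measure E3) : Prop :=
  IsFiniteMeasureOnCompacts γ ∧
    ∃ r : ℕ → ℝ, Tendsto r atTop atTop ∧
      ∀ f : E3 → ℝ, Continuous f → HasCompactSupport f →
        Tendsto (fun n => ∫ x, f x ∂(finiteAutocorrelation Λ (r n))) atTop (𝓝 (∫ x, f x ∂γ))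

/-- The measure `μ` is the Fourier transform of the measure `γ` in the sense of tempered
distributions: `⟨μ, f⟩ = ⟨γ, 𝓕 f⟩` for all Schwartz functions `f`. -/
def IsFourierTransform (γ μ : Measure E3) : Prop :=
  IsFiniteMeasureOnCompacts μ ∧
    ∀ f : 𝓢(E3, ℂ), Integrable (fun x => f x) μ ∧ Integrable (fun x => (𝓕 f) x) γ ∧
      ∫ x, f x ∂μ = ∫ x, (𝓕 f) x ∂γ

/-- The cylinder surface of radius `ρ` around the axis `ℝ e₃`. -/
def axisCylinder (ρ : ℝ) : Set E3 := {x | Real.sqrt (x 0 ^ 2 + x 1 ^ 2) = ρ}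

/-- The line through `y` parallel to the axis `ℝ e₃`. -/
def verticalLine (y : E3) : Set E3 := {x | x 0 = y 0 ∧ x 1 = y 1}

end

/-!
The transform `μ` of an autocorrelation `γ` is obtained as a limit of the finite diffraction
measures `r⁻³ |∑ e^{-2πi⟨ξ, x⟩}|² dξ` (sum over `x ∈ Λ ∩ C_r`), which are the transforms of the
finite autocorrelations. Only the uniform discreteness of `Λ` matters for this. A packing argument
bounds the finite autocorrelations uniformly on the weight `(1 + ‖x‖)⁻⁴`, so their vague
convergence extends to Schwartz functions. Pairing with Gaussians of widths `2 ^ k`, whose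
transforms are known, carries the bound over to the diffraction measures. Multiplied by a density
that decays slightly faster than the weight, they form a tight family, and Prokhorov's theorem
yields `μ` (`UniformlyDiscrete.exists_isFourierTransform`). Uniqueness holds since smooth test
functions determine a locally finite measure.

For the support, let `f` be a test function whose support avoids `M`. A layer of `Λ` is a
translate of a rotated lattice `R ^ m Γ`, and some `e^{2πi⟨ξ, v⟩} - 1` with `v = R ^ m 𝐚` or `v =
R ^ m 𝐛` is nonzero at each point `ξ` of the support. Hence `f` is a combination of these two
functions with smooth coefficients, `𝓕 f` is a sum of differences `𝓕 h (w - v) - 𝓕 h w`, and its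
sum over the layer telescopes to `0` (`tsum_fourier_eq_zero`, which takes the place of Poisson
summation). So `∑ 𝓕 f (x - y)` over all `x ∈ Λ` vanishes for every `y`. In the mean over `x, y ∈ Λ
∩ C_r` only the pairs near the boundary of the cube survive, and these are negligible
(`UniformlyDiscrete.tendsto_sum_patch_zero`). Therefore `∫ f dμ = 0`, and `μ` lives on `M`.

Since the rotations preserve lengths and the lengths of dual lattice vectors form a closed set,
`M` lies in a countable union of cylinders, which is a null set; this gives the singularity. If
`φ` is not a rational multiple of `π`, the angles `-mφ` are dense modulo `2π` and `M` is the whole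
union of cylinders. Otherwise finitely many rotations occur, and the union over them needs no
closure.
-/

/-! ### A polynomial weight -/

/-- The weight `(1 + ‖x‖)⁻⁴`. The exponent `4` is the smallest integer for which it is integrable
on `E3`. -/
noncomputable def weight (x : E3) : ℝ := ((1 + ‖x‖) ^ 4)⁻¹

lemma weight_pos (x : E3) : 0 < weight x := by unfold weight; positivity

lemma continuous_weight : Continuous weight := by
  unfold weight
  exact Continuous.inv₀ (by fun_prop) fun x => by positivity

lemma integrable_weight : Integrable weight := by
  have := integrable_one_add_norm (E := E3) (μ := volume) (r := 4) (by simp; norm_num)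
  refine this.congr (Eventually.of_forall fun x => ?_)
  simp only [weight]
  rw [Real.rpow_neg (by positivity)]
  norm_cast

/-- On a ball of fixed radius the weight is constant up to a bounded factor. -/
lemma weight_le_mul_weight (x y : E3) : weight x ≤ (1 + ‖y - x‖) ^ 4 * weight y := by
  have h : 1 + ‖y‖ ≤ (1 + ‖y - x‖) * (1 + ‖x‖) := by
    have : ‖y‖ ≤ ‖y - x‖ + ‖x‖ := by simpa using norm_add_le (y - x) x
    nlinarith [norm_nonneg (y - x), norm_nonneg x]
  unfold weight
  rw [← div_eq_mul_inv, inv_eq_one_div, div_le_div_iff₀ (by positivity) (by positivity), one_mul,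
    ← mul_pow]
  gcongr

/-- Schwartz functions decay faster than the weight times any power of `1 + ‖x‖`. -/
lemma SchwartzMap.exists_norm_le_weight (f : 𝓢(E3, ℂ)) (k : ℕ) :
    ∃ K : ℝ, 0 ≤ K ∧ ∀ x, ‖f x‖ ≤ K * (weight x / (1 + ‖x‖) ^ k) := by
  have h := SchwartzMap.one_add_le_sup_seminorm_apply (𝕜 := ℂ) (m := (4 + k, 0)) (k := 4 + k)
    (n := 0) le_rfl le_rfl f
  refine ⟨_, le_trans (by positivity) (h 0), fun x => ?_⟩
  have hx := h x
  rw [norm_iteratedFDeriv_zero] at hx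
  have : weight x / (1 + ‖x‖) ^ k = ((1 + ‖x‖) ^ (4 + k))⁻¹ := by
    rw [weight, pow_add, mul_inv, div_eq_mul_inv]
  rw [this, ← div_eq_mul_inv, le_div_iff₀ (by positivity), mul_comm]
  exact hx

/-! ### Uniformly discrete sets -/

/-- A set of points with a positive lower bound for the distances of distinct points. -/
def UniformlyDiscrete (Λ : Set E3) : Prop :=
  ∃ ε : ℝ, 0 < ε ∧ Λ.Pairwise fun x y => ε ≤ dist x y

lemma measurableSet_cube (r : ℝ) : MeasurableSet (cube r) := by
  have : IsClosed (cube r) := by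
    simp only [cube, Set.ofPred_forall]
    exact isClosed_iInter fun i => isClosed_le (by fun_prop) continuous_const
  exact this.measurableSet

lemma volume_cube (r : ℝ) : volume (cube r) = ENNReal.ofReal r ^ 3 := by
  have h := (EuclideanSpace.volume_preserving_symm_measurableEquiv_toLp (Fin 3)).measure_preimage
    (s := Icc (fun _ => -(r / 2)) (fun _ => r / 2)) measurableSet_Icc.nullMeasurableSet
  have h2 : (MeasurableEquiv.toLp 2 (Fin 3 → ℝ)).symm ⁻¹'
      (Icc (fun _ => -(r / 2)) (fun _ => r / 2)) = cube r := by
    ext x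
    simp [cube, Pi.le_def, abs_le, forall_and]
  rw [← h2, h, Real.volume_Icc_pi]
  simp

lemma volume_real_cube {r : ℝ} (hr : 0 ≤ r) : volume.real (cube r) = r ^ 3 := by
  rw [measureReal_def, volume_cube, ENNReal.toReal_pow, ENNReal.toReal_ofReal hr]

lemma cube_mono {r s : ℝ} (h : r ≤ s) : cube r ⊆ cube s := fun x hx i => by
  have := hx i
  linarith

lemma abs_apply_le_norm (x : E3) (i : Fin 3) : |x i| ≤ ‖x‖ := by
  simpa using PiLp.norm_apply_le x i

lemma volume_real_ball_pos {ε : ℝ} (hε : 0 < ε) :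
    0 < volume.real (Metric.ball (0 : E3) (ε / 2)) := by
  rw [measureReal_def, ENNReal.toReal_pos_iff]
  exact ⟨Metric.measure_ball_pos _ _ (by positivity), measure_ball_lt_top⟩

lemma ball_subset_cube {r ε : ℝ} {x : E3} (hx : x ∈ cube r) :
    Metric.ball x (ε / 2) ⊆ cube (r + ε) := fun y hy i => by
  have h1 := hx i
  have h2 := abs_apply_le_norm (y - x) i
  rw [← dist_eq_norm] at h2
  have h3 := Metric.mem_ball.1 hy
  have h4 := abs_add_le (x i) ((y - x) i)
  rw [PiLp.sub_apply] at h4 h2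
  rw [add_sub_cancel] at h4
  linarith

lemma pairwiseDisjoint_ball {ε : ℝ} {s : Set E3} (hs : s.Pairwise fun x y => ε ≤ dist x y) :
    s.Pairwise (Function.onFun Disjoint fun x => Metric.ball x (ε / 2)) := fun x hx y hy hxy =>
  Metric.ball_disjoint_ball (by linarith [hs hx hy hxy])

/-- Separated points are no more than the volume of a neighbourhood allows. -/
lemma card_mul_le_volume {ε : ℝ} {s : Finset E3}
    (hs : (s : Set E3).Pairwise fun x y => ε ≤ dist x y) {A : Set E3}
    (hA : ∀ x ∈ s, Metric.ball x (ε / 2) ⊆ A) (hfin : volume A ≠ ⊤) :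
    s.card * volume.real (Metric.ball (0 : E3) (ε / 2)) ≤ volume.real A := by
  have h1 : volume.real (⋃ x ∈ s, Metric.ball x (ε / 2)) =
      ∑ x ∈ s, volume.real (Metric.ball x (ε / 2)) :=
    measureReal_biUnion_finset (pairwiseDisjoint_ball hs) (fun x _ => measurableSet_ball)
  have h2 : ∀ x : E3, volume.real (Metric.ball x (ε / 2)) =
      volume.real (Metric.ball (0 : E3) (ε / 2)) := fun x => by
    simp only [measureReal_def]
    rw [Measure.addHaar_ball_center]
  calc s.card * volume.real (Metric.ball (0 : E3) (ε / 2))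
      = ∑ x ∈ s, volume.real (Metric.ball x (ε / 2)) := by simp [h2]
    _ = _ := h1.symm
    _ ≤ volume.real A := measureReal_mono (iUnion₂_subset hA) hfin

/-- The translates of the weight by the points of a uniformly discrete set have uniformly bounded
sums. -/
lemma UniformlyDiscrete.exists_sum_weight_le {Λ : Set E3} (hΛ : UniformlyDiscrete Λ) :
    ∃ C : ℝ, 0 ≤ C ∧ ∀ (u : E3) (s : Finset E3), (s : Set E3) ⊆ Λ →
      ∑ x ∈ s, weight (x - u) ≤ C := by
  obtain ⟨ε, hε, hsep⟩ := hΛ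
  set V := volume.real (Metric.ball (0 : E3) (ε / 2)) with hV
  have hVpos : 0 < V := volume_real_ball_pos hε
  have hI : 0 ≤ ∫ t, weight t := integral_nonneg fun t => (weight_pos t).le
  refine ⟨(1 + ε) ^ 4 * (∫ t, weight t) / V, by positivity, fun u s hs => ?_⟩
  rw [le_div_iff₀ hVpos, Finset.sum_mul]
  have hint : Integrable fun t => weight (t - u) := integrable_weight.comp_sub_right u
  have key : ∀ x : E3, weight (x - u) * V ≤
      (1 + ε) ^ 4 * ∫ t in Metric.ball x (ε / 2), weight (t - u) := fun x => by
    have hc : weight (x - u) * V = ∫ t in Metric.ball x (ε / 2), weight (x - u) := by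
      rw [setIntegral_const, smul_eq_mul, mul_comm]
      simp only [hV, measureReal_def]
      rw [Measure.addHaar_ball_center volume x]
    rw [hc, ← integral_const_mul]
    refine setIntegral_mono_on (integrableOn_const measure_ball_lt_top.ne)
      (hint.integrableOn.const_mul _) measurableSet_ball fun t ht => ?_
    refine (weight_le_mul_weight (x - u) (t - u)).trans ?_
    have : ‖t - u - (x - u)‖ ≤ ε := by
      rw [sub_sub_sub_cancel_right, ← dist_eq_norm]
      linarith [Metric.mem_ball.1 ht]
    have := (weight_pos (t - u)).le
    gcongr
  calc ∑ x ∈ s, weight (x - u) * V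
      ≤ ∑ x ∈ s, (1 + ε) ^ 4 * ∫ t in Metric.ball x (ε / 2), weight (t - u) :=
        Finset.sum_le_sum fun x _ => key x
    _ = (1 + ε) ^ 4 * ∫ t in ⋃ x ∈ s, Metric.ball x (ε / 2), weight (t - u) := by
        rw [← Finset.mul_sum, integral_biUnion_finset s (fun x _ => measurableSet_ball)
          (pairwiseDisjoint_ball (hsep.mono hs)) (fun x _ => hint.integrableOn)]
    _ ≤ (1 + ε) ^ 4 * ∫ t, weight (t - u) := by
        exact mul_le_mul_of_nonneg_left (setIntegral_le_integral hint
          (Eventually.of_forall fun t => (weight_pos _).le)) (by positivity)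
    _ = _ := by rw [integral_sub_right_eq_self weight u]

lemma UniformlyDiscrete.exists_tsum_weight_le {Λ : Set E3} (hΛ : UniformlyDiscrete Λ) :
    ∃ C : ℝ, 0 ≤ C ∧ ∀ u : E3, Summable (fun x : Λ => weight (x - u)) ∧
      ∑' x : Λ, weight (x - u) ≤ C := by
  obtain ⟨C, hC, h⟩ := hΛ.exists_sum_weight_le
  have key : ∀ (u : E3) (s : Finset Λ), ∑ x ∈ s, weight (x - u) ≤ C := fun u s => by
    have := h u (s.map (Function.Embedding.subtype _)) (by simp)
    simpa using this
  exact ⟨C, hC, fun u => ⟨summable_of_sum_le (fun x => (weight_pos _).le) (key u),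
    Real.tsum_le_of_sum_le (fun x => (weight_pos _).le) (key u)⟩⟩

lemma UniformlyDiscrete.finite_inter_cube {Λ : Set E3} (hΛ : UniformlyDiscrete Λ) (r : ℝ) :
    (Λ ∩ cube r).Finite := by
  obtain ⟨ε, hε, hsep⟩ := hΛ
  have hVpos := volume_real_ball_pos hε
  by_contra hinf
  obtain ⟨n, hn⟩ := exists_nat_gt
    (volume.real (cube (r + ε)) / volume.real (Metric.ball (0 : E3) (ε / 2)))
  obtain ⟨t, ht, rfl⟩ := Set.Infinite.exists_subset_card_eq hinf n
  rw [div_lt_iff₀ hVpos] at hn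
  exact absurd (card_mul_le_volume (hsep.mono (ht.trans inter_subset_left))
    (fun x hx => ball_subset_cube (ht hx).2) (by rw [volume_cube]; finiteness)) (not_le.2 hn)

open Classical in
/-- The finite set `Λ ∩ C_r`, for a uniformly discrete set `Λ` (with the junk value `∅` for the
sets `Λ` for which the intersection is infinite). -/
noncomputable def patch (Λ : Set E3) (r : ℝ) : Finset E3 :=
  if h : (Λ ∩ cube r).Finite then h.toFinset else ∅

namespace UniformlyDiscrete

variable {Λ : Set E3}

lemma mem_patch (hΛ : UniformlyDiscrete Λ) {r : ℝ} {x : E3} :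
    x ∈ patch Λ r ↔ x ∈ Λ ∧ x ∈ cube r := by
  simp [patch, hΛ.finite_inter_cube r]

lemma patch_subset (hΛ : UniformlyDiscrete Λ) (r : ℝ) : (patch Λ r : Set E3) ⊆ Λ :=
  fun _ hx => (hΛ.mem_patch.1 hx).1

lemma integral_finiteAutocorrelation {F : Type*} [NormedAddCommGroup F] [NormedSpace ℝ F]
    [CompleteSpace F] (hΛ : UniformlyDiscrete Λ) {r : ℝ} (hr : 0 ≤ r) (f : E3 → F) :
    Integrable f (finiteAutocorrelation Λ r) ∧ ∫ x, f x ∂(finiteAutocorrelation Λ r) =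
      (r ^ 3)⁻¹ • ∑ x ∈ patch Λ r, ∑ y ∈ patch Λ r, f (x - y) := by
  have := (hΛ.finite_inter_cube r).to_subtype
  have := Fintype.ofFinite (Λ ∩ cube r : Set E3)
  have hd : ∀ p : (Λ ∩ cube r : Set E3) × (Λ ∩ cube r : Set E3),
      Integrable f (Measure.dirac ((p.1 : E3) - (p.2 : E3))) := fun p =>
    integrable_dirac enorm_lt_top
  rw [finiteAutocorrelation, Measure.sum_fintype]
  constructor
  · exact (integrable_finsetSum_measure.2 fun p _ => hd p).smul_measure (by simp)
  · rw [integral_smul_measure, integral_finsetSum_measure fun p _ => hd p]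
    rw [Finset.sum_congr rfl fun p _ => integral_dirac f _,
      ENNReal.toReal_ofReal (by positivity), Fintype.sum_prod_type]
    congr 1
    have hs : ∀ g : E3 → F, ∑ x : (Λ ∩ cube r : Set E3), g x = ∑ x ∈ patch Λ r, g x := fun g => by
      rw [patch, dif_pos (hΛ.finite_inter_cube r)]
      exact (Finset.sum_subtype _ (by simp) g).symm
    refine (Finset.sum_congr rfl fun (x : (Λ ∩ cube r : Set E3)) _ =>
      hs fun y => f (x - y)).trans ?_
    exact hs fun x => ∑ y ∈ patch Λ r, f (x - y)

/-- The number of points in a cube is at most proportional to the volume. -/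
lemma exists_card_patch_le (hΛ : UniformlyDiscrete Λ) :
    ∃ C : ℝ, 0 ≤ C ∧ ∀ r : ℝ, 1 ≤ r → (r ^ 3)⁻¹ * (patch Λ r).card ≤ C := by
  have hΛ' := hΛ
  obtain ⟨ε, hε, hsep⟩ := hΛ
  set V := volume.real (Metric.ball (0 : E3) (ε / 2)) with hV
  have hVpos : 0 < V := volume_real_ball_pos hε
  refine ⟨(1 + ε) ^ 3 / V, by positivity, fun r hr => ?_⟩
  have h := card_mul_le_volume (A := cube (r + ε)) (hsep.mono (hΛ'.patch_subset r))
    (fun x hx => ball_subset_cube (hΛ'.mem_patch.1 hx).2) (by rw [volume_cube]; finiteness)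
  rw [volume_real_cube (by linarith)] at h
  have hr3 : (0 : ℝ) < r ^ 3 := by positivity
  rw [inv_mul_le_iff₀ hr3, mul_div_assoc', le_div_iff₀ hVpos, ← mul_pow]
  refine h.trans ?_
  gcongr
  nlinarith

open Classical in
/-- The points of `Λ ∩ C_r` at a bounded distance from the boundary of `C_r` have density `0`. -/
lemma tendsto_card_boundary (hΛ : UniformlyDiscrete Λ) {s : ℝ} (hs : 0 ≤ s) :
    Tendsto (fun r : ℝ => (r ^ 3)⁻¹ * (patch Λ r \ patch Λ (r - 2 * s)).card) atTop
      (𝓝 0) := by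
  have hΛ' := hΛ
  obtain ⟨ε, hε, hsep⟩ := hΛ
  set V := volume.real (Metric.ball (0 : E3) (ε / 2)) with hV
  have hVpos : 0 < V := volume_real_ball_pos hε
  have hlim : Tendsto (fun r : ℝ => ((1 + ε * r⁻¹) ^ 3 - (1 - (2 * s + ε) * r⁻¹) ^ 3) / V) atTop
      (𝓝 (((1 + ε * 0) ^ 3 - (1 - (2 * s + ε) * 0) ^ 3) / V)) := by
    have := tendsto_inv_atTop_zero (𝕜 := ℝ)
    exact (((this.const_mul _).const_add _).pow 3 |>.sub
      (((this.const_mul _).const_sub _).pow 3)).div_const _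
  have hz : ((1 + ε * 0) ^ 3 - (1 - (2 * s + ε) * 0) ^ 3) / V = 0 := by simp
  rw [hz] at hlim
  refine squeeze_zero' ?_ ?_ hlim
  · filter_upwards [eventually_ge_atTop 0] with r hr
    exact mul_nonneg (by positivity) (Nat.cast_nonneg _)
  filter_upwards [eventually_ge_atTop (2 * s + ε)] with r hr
  have hr0 : 0 < r := by linarith
  have h := card_mul_le_volume (ε := ε) (s := patch Λ r \ patch Λ (r - 2 * s))
    (A := cube (r + ε) \ cube (r - 2 * s - ε))
    (hsep.mono ((Finset.coe_subset.2 Finset.sdiff_subset).trans (hΛ'.patch_subset r)))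
    (fun x hx y hy => ?_)
    (ne_top_of_le_ne_top (by rw [volume_cube]; finiteness) (measure_mono sdiff_subset))
  · rw [measureReal_sdiff (cube_mono (by linarith)) (measurableSet_cube _)
      (by rw [volume_cube]; finiteness), volume_real_cube (by linarith),
      volume_real_cube (by linarith)] at h
    have hr3 : (0 : ℝ) < r ^ 3 := by positivity
    rw [le_div_iff₀ hVpos, mul_assoc, inv_mul_le_iff₀ hr3]
    refine h.trans_eq ?_
    field_simp
    ring
  · obtain ⟨hx, hx'⟩ := Finset.mem_sdiff.1 hx
    obtain ⟨hxΛ, hxr⟩ := hΛ'.mem_patch.1 hx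
    refine ⟨ball_subset_cube hxr hy, fun hy' => hx' (hΛ'.mem_patch.2 ⟨hxΛ, ?_⟩)⟩
    have := ball_subset_cube (ε := ε) hy' (Metric.mem_ball_comm.1 hy)
    rwa [sub_add_cancel] at this

/-- The finite autocorrelations are uniformly bounded on the weight. -/
lemma exists_integral_weight_le (hΛ : UniformlyDiscrete Λ) :
    ∃ C : ℝ, 0 ≤ C ∧ ∀ r : ℝ, 1 ≤ r → ∫ x, weight x ∂(finiteAutocorrelation Λ r) ≤ C := by
  obtain ⟨C₁, h₁, hC₁⟩ := hΛ.exists_sum_weight_le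
  obtain ⟨C₂, h₂, hC₂⟩ := hΛ.exists_card_patch_le
  refine ⟨C₂ * C₁, by positivity, fun r hr => ?_⟩
  rw [(hΛ.integral_finiteAutocorrelation (by linarith) _).2, smul_eq_mul, Finset.sum_comm]
  calc (r ^ 3)⁻¹ * ∑ y ∈ patch Λ r, ∑ x ∈ patch Λ r, weight (x - y)
      ≤ (r ^ 3)⁻¹ * ∑ y ∈ patch Λ r, C₁ := by
        gcongr with y hy
        exact hC₁ y _ (hΛ.patch_subset r)
    _ = (r ^ 3)⁻¹ * (patch Λ r).card * C₁ := by simp [mul_assoc]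
    _ ≤ C₂ * C₁ := by gcongr; exact hC₂ r hr

end UniformlyDiscrete

/-! ### Vague convergence tested on decaying functions -/

/-- A continuous cutoff function, equal to `1` on the ball of radius `R` and to `0` outside the
ball of radius `R + 1`. -/
noncomputable def cutoff (R : ℝ) (x : E3) : ℝ := max 0 (min 1 (R + 1 - ‖x‖))

lemma continuous_cutoff (R : ℝ) : Continuous (cutoff R) := by unfold cutoff; fun_prop

lemma cutoff_nonneg (R : ℝ) (x : E3) : 0 ≤ cutoff R x := le_max_left _ _

lemma cutoff_le_one (R : ℝ) (x : E3) : cutoff R x ≤ 1 := max_le zero_le_one (min_le_left _ _)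

lemma cutoff_eq_one {R : ℝ} {x : E3} (h : ‖x‖ ≤ R) : cutoff R x = 1 := by
  rw [cutoff, min_eq_left (by linarith), max_eq_right zero_le_one]

lemma hasCompactSupport_cutoff (R : ℝ) : HasCompactSupport (cutoff R) :=
  HasCompactSupport.intro (isCompact_closedBall (0 : E3) (R + 1)) fun x hx => by
    rw [Metric.mem_closedBall, dist_zero_right, not_le] at hx
    exact max_eq_left (min_le_of_right_le (by linarith))

lemma abs_le_weight_of_le {f : E3 → ℝ} {K : ℝ} (hK : 0 ≤ K)
    (hfK : ∀ x, |f x| ≤ K * (weight x / (1 + ‖x‖))) (x : E3) : |f x| ≤ K * weight x := by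
  refine (hfK x).trans (mul_le_mul_of_nonneg_left ?_ hK)
  exact div_le_self (weight_pos x).le (by linarith [norm_nonneg x])

lemma integrable_of_le_weight {F : Type*} [NormedAddCommGroup F] {μ : Measure E3}
    (hμ : Integrable weight μ) {f : E3 → F} (hf : AEStronglyMeasurable f μ) {K : ℝ} (hK : 0 ≤ K)
    (hfK : ∀ x, ‖f x‖ ≤ K * (weight x / (1 + ‖x‖))) : Integrable f μ := by
  refine (hμ.const_mul K).mono' hf (Eventually.of_forall fun x => ?_)
  have := abs_le_weight_of_le (f := fun x => ‖f x‖) hK (by simpa using hfK) x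
  simpa using this

/-- Cutting off a decaying function changes its integral by little, uniformly for all measures
with a given bound on the weight. -/
lemma abs_integral_sub_integral_cutoff_le {μ : Measure E3} (hμ : Integrable weight μ) {C : ℝ}
    (hC : ∫ x, weight x ∂μ ≤ C) {f : E3 → ℝ} (hf : Continuous f) {K : ℝ} (hK : 0 ≤ K)
    (hfK : ∀ x, |f x| ≤ K * (weight x / (1 + ‖x‖))) {R : ℝ} (hR : 0 ≤ R) :
    |∫ x, f x ∂μ - ∫ x, f x * cutoff R x ∂μ| ≤ K * C / (1 + R) := by
  have hfi : Integrable f μ := integrable_of_le_weight hμ hf.aestronglyMeasurable hK hfK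
  have hfc : Integrable (fun x => f x * cutoff R x) μ := by
    refine hfi.norm.mono' (hf.mul (continuous_cutoff R)).aestronglyMeasurable
      (Eventually.of_forall fun x => ?_)
    rw [norm_mul, Real.norm_of_nonneg (cutoff_nonneg R x)]
    exact mul_le_of_le_one_right (norm_nonneg _) (cutoff_le_one R x)
  rw [← integral_sub hfi hfc]
  have hpt : ∀ x, ‖f x - f x * cutoff R x‖ ≤ K / (1 + R) * weight x := fun x => by
    rw [← mul_one_sub, norm_mul, Real.norm_of_nonneg (sub_nonneg.2 (cutoff_le_one R x))]
    rcases le_or_gt ‖x‖ R with h | h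
    · rw [cutoff_eq_one h, sub_self, mul_zero]
      have := (weight_pos x).le
      positivity
    · refine (mul_le_of_le_one_right (norm_nonneg _) (by linarith [cutoff_nonneg R x])).trans
        ((hfK x).trans ?_)
      rw [div_mul_eq_mul_div, mul_div_assoc]
      have := (weight_pos x).le
      gcongr
  refine (norm_integral_le_of_norm_le (hμ.const_mul _) (Eventually.of_forall hpt)).trans ?_
  rw [integral_const_mul, div_mul_eq_mul_div]
  gcongr

section VagueLimit

variable {γ : Measure E3} {γn : ℕ → Measure E3} {C : ℝ}

/-- A uniform bound on the weight is inherited by vague limits. -/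
lemma integrable_weight_of_vague [IsFiniteMeasureOnCompacts γ]
    (hw : ∀ n, Integrable weight (γn n)) (hb : ∀ n, ∫ x, weight x ∂(γn n) ≤ C)
    (hv : ∀ f : E3 → ℝ, Continuous f → HasCompactSupport f →
      Tendsto (fun n => ∫ x, f x ∂(γn n)) atTop (𝓝 (∫ x, f x ∂γ))) :
    Integrable weight γ ∧ ∫ x, weight x ∂γ ≤ C := by
  have hcont : ∀ k : ℕ, Continuous fun x => weight x * cutoff k x := fun k =>
    continuous_weight.mul (continuous_cutoff _)
  have hsupp : ∀ k : ℕ, HasCompactSupport fun x => weight x * cutoff k x := fun k =>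
    (hasCompactSupport_cutoff k).mul_left
  have hle : ∀ k : ℕ, ∫ x, weight x * cutoff k x ∂γ ≤ C := fun k => by
    refine le_of_tendsto (hv _ (hcont k) (hsupp k)) (Eventually.of_forall fun n => ?_)
    refine (integral_mono_of_nonneg (Eventually.of_forall fun x =>
      mul_nonneg (weight_pos x).le (cutoff_nonneg _ x)) (hw n) (Eventually.of_forall fun x =>
      mul_le_of_le_one_right (weight_pos x).le (cutoff_le_one _ x))).trans (hb n)
  have hcov : AECover γ atTop fun k : ℕ => Metric.closedBall (0 : E3) k :=
    aecover_closedBall tendsto_natCast_atTop_atTop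
  have hle' : ∀ k : ℕ, ∫ x in Metric.closedBall (0 : E3) k, ‖weight x‖ ∂γ ≤ C := fun k => by
    refine le_trans ?_ (hle k)
    have hi : Integrable (fun x => weight x * cutoff k x) γ :=
      (hcont k).integrable_of_hasCompactSupport (hsupp k)
    rw [setIntegral_congr_fun (g := fun x => weight x * cutoff k x) measurableSet_closedBall]
    · exact setIntegral_le_integral hi (Eventually.of_forall fun x =>
        mul_nonneg (weight_pos x).le (cutoff_nonneg _ x))
    · intro x hx
      simp only
      rw [cutoff_eq_one (by simpa using hx), mul_one, Real.norm_of_nonneg (weight_pos x).le]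
  have hint : Integrable weight γ := by
    refine hcov.integrable_of_integral_norm_bounded C (fun k => ?_) (Eventually.of_forall hle')
    exact continuous_weight.continuousOn.integrableOn_compact (isCompact_closedBall _ _)
  refine ⟨hint, le_of_tendsto (hcov.integral_tendsto_of_countably_generated hint)
    (Eventually.of_forall fun k => ?_)⟩
  refine (le_of_eq ?_).trans (hle' k)
  simp_rw [Real.norm_of_nonneg (weight_pos _).le]

/-- Under a uniform bound on the weight, vague convergence extends from compactly supported to
decaying functions. -/
lemma tendsto_integral_of_vague [IsFiniteMeasureOnCompacts γ]
    (hw : ∀ n, Integrable weight (γn n)) (hb : ∀ n, ∫ x, weight x ∂(γn n) ≤ C)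
    (hv : ∀ f : E3 → ℝ, Continuous f → HasCompactSupport f →
      Tendsto (fun n => ∫ x, f x ∂(γn n)) atTop (𝓝 (∫ x, f x ∂γ)))
    {f : E3 → ℝ} (hf : Continuous f) {K : ℝ} (hK : 0 ≤ K)
    (hfK : ∀ x, |f x| ≤ K * (weight x / (1 + ‖x‖))) :
    Tendsto (fun n => ∫ x, f x ∂(γn n)) atTop (𝓝 (∫ x, f x ∂γ)) := by
  obtain ⟨hwγ, hbγ⟩ := integrable_weight_of_vague hw hb hv
  rw [Metric.tendsto_nhds]
  intro δ hδ
  have hlim : Tendsto (fun k : ℕ => K * C / (1 + (k : ℝ))) atTop (𝓝 0) :=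
    tendsto_const_nhds.div_atTop (tendsto_const_nhds.add_atTop tendsto_natCast_atTop_atTop)
  obtain ⟨k, hk⟩ := (hlim.eventually_lt_const (show 0 < δ / 3 by positivity)).exists
  have h1 := abs_integral_sub_integral_cutoff_le hwγ hbγ hf hK hfK (Nat.cast_nonneg k)
  have h2 := Metric.tendsto_nhds.1 (hv (fun x => f x * cutoff k x)
    (hf.mul (continuous_cutoff _)) (hasCompactSupport_cutoff _).mul_left) (δ / 3) (by positivity)
  filter_upwards [h2] with n hn
  have h3 := abs_integral_sub_integral_cutoff_le (hw n) (hb n) hf hK hfK (Nat.cast_nonneg k)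
  rw [Real.dist_eq] at hn ⊢
  rw [abs_lt] at hn ⊢
  rw [abs_le] at h1 h3
  constructor <;> linarith [hn.1, hn.2, h1.1, h1.2, h3.1, h3.2]

lemma tendsto_integral_complex_of_vague [IsFiniteMeasureOnCompacts γ]
    (hw : ∀ n, Integrable weight (γn n)) (hb : ∀ n, ∫ x, weight x ∂(γn n) ≤ C)
    (hv : ∀ f : E3 → ℝ, Continuous f → HasCompactSupport f →
      Tendsto (fun n => ∫ x, f x ∂(γn n)) atTop (𝓝 (∫ x, f x ∂γ)))
    {f : E3 → ℂ} (hf : Continuous f) {K : ℝ} (hK : 0 ≤ K)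
    (hfK : ∀ x, ‖f x‖ ≤ K * (weight x / (1 + ‖x‖))) :
    Tendsto (fun n => ∫ x, f x ∂(γn n)) atTop (𝓝 (∫ x, f x ∂γ)) := by
  have hre := tendsto_integral_of_vague hw hb hv (Complex.continuous_re.comp hf) hK
    fun x => (Complex.abs_re_le_norm _).trans (hfK x)
  have him := tendsto_integral_of_vague hw hb hv (Complex.continuous_im.comp hf) hK
    fun x => (Complex.abs_im_le_norm _).trans (hfK x)
  have key : ∀ μ : Measure E3, Integrable weight μ → ∫ x, f x ∂μ =
      ((∫ x, (f x).re ∂μ : ℝ) : ℂ) + ((∫ x, (f x).im ∂μ : ℝ) : ℂ) * Complex.I := fun μ hμ =>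
    (integral_re_add_im (𝕜 := ℂ)
      (integrable_of_le_weight hμ hf.aestronglyMeasurable hK hfK)).symm
  rw [key γ (integrable_weight_of_vague hw hb hv).1]
  simp_rw [key _ (hw _)]
  exact ((Complex.continuous_ofReal.tendsto _).comp hre).add
    (((Complex.continuous_ofReal.tendsto _).comp him).mul_const _)

/-! ### Compactness of measures with a bound on the weight -/

/-- Measures with a uniform bound on the weight become, on multiplication with a density that
decays slightly faster, a tight family of finite measures, so that Prokhorov's theorem applies. -/
lemma exists_limit_of_integral_weight_le {μn : ℕ → Measure E3}
    (hw : ∀ n, Integrable weight (μn n)) (hb : ∀ n, ∫ x, weight x ∂(μn n) ≤ C) :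
    ∃ μ : Measure E3, IsFiniteMeasureOnCompacts μ ∧ ∃ U : Ultrafilter ℕ, (U : Filter ℕ) ≤ atTop ∧
      ∀ f : E3 → ℂ, Continuous f → ∀ K : ℝ, (∀ x, ‖f x‖ ≤ K * (weight x / (1 + ‖x‖))) →
        Integrable f μ ∧ Tendsto (fun n => ∫ x, f x ∂(μn n)) U (𝓝 (∫ x, f x ∂μ)) := by
  set d : E3 → ℝ := fun x => weight x / (1 + ‖x‖) with hd
  have hdpos : ∀ x, 0 < d x := fun x => div_pos (weight_pos x) (by positivity)
  have hdc : Continuous d := continuous_weight.div (by fun_prop) fun x => by positivity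
  have hdle : ∀ x, d x ≤ weight x := fun x =>
    div_le_self (weight_pos x).le (by linarith [norm_nonneg x])
  have hC : 0 ≤ C := (integral_nonneg fun x => (weight_pos x).le).trans (hb 0)
  have hlint : ∀ n, ∫⁻ x, ENNReal.ofReal (weight x) ∂(μn n) ≤ ENNReal.ofReal C := fun n => by
    rw [← ofReal_integral_eq_lintegral_ofReal (hw n)
      (Eventually.of_forall fun x => (weight_pos x).le)]
    exact ENNReal.ofReal_le_ofReal (hb n)
  let ν' : ℕ → Measure E3 := fun n => (μn n).withDensity fun x => ENNReal.ofReal (d x)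
  have hν'univ : ∀ n, ν' n univ ≤ ENNReal.ofReal C := fun n => by
    rw [withDensity_apply _ MeasurableSet.univ, Measure.restrict_univ]
    exact (lintegral_mono fun x => ENNReal.ofReal_le_ofReal (hdle x)).trans (hlint n)
  have hν'tail : ∀ n (k : ℕ), ν' n (Metric.closedBall (0 : E3) k)ᶜ ≤
      ENNReal.ofReal (C / (1 + k)) := fun n k => by
    rw [withDensity_apply _ measurableSet_closedBall.compl]
    calc ∫⁻ x in (Metric.closedBall (0 : E3) k)ᶜ, ENNReal.ofReal (d x) ∂(μn n)
        ≤ ∫⁻ x in (Metric.closedBall (0 : E3) k)ᶜ,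
            ENNReal.ofReal (1 / (1 + k)) * ENNReal.ofReal (weight x) ∂(μn n) := by
          refine setLIntegral_mono' measurableSet_closedBall.compl fun x hx => ?_
          rw [← ENNReal.ofReal_mul (by positivity)]
          refine ENNReal.ofReal_le_ofReal ?_
          have hx' : (k : ℝ) < ‖x‖ := by simpa using hx
          have := (weight_pos x).le
          rw [hd, one_div_mul_eq_div]
          dsimp only
          gcongr
      _ ≤ ∫⁻ x, ENNReal.ofReal (1 / (1 + k)) * ENNReal.ofReal (weight x) ∂(μn n) :=
          setLIntegral_le_lintegral _ _
      _ ≤ ENNReal.ofReal (1 / (1 + k)) * ENNReal.ofReal C := by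
          rw [lintegral_const_mul' _ _ ENNReal.ofReal_ne_top]
          exact mul_le_mul_right (hlint n) _
      _ = ENNReal.ofReal (C / (1 + k)) := by
          rw [← ENNReal.ofReal_mul (by positivity), one_div_mul_eq_div]
  let ν : ℕ → FiniteMeasure E3 := fun n =>
    ⟨ν' n, ⟨(hν'univ n).trans_lt ENNReal.ofReal_lt_top⟩⟩
  have hcomp := isCompact_setOfPred_finiteMeasure_mass_le_compl_isCompact_le (E := E3)
    (u := fun k : ℕ => (C / (1 + k)).toNNReal) (K := fun k : ℕ => Metric.closedBall (0 : E3) k)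
    C.toNNReal
    (by
      have : Tendsto (fun k : ℕ => C / (1 + (k : ℝ))) atTop (𝓝 0) :=
        tendsto_const_nhds.div_atTop (tendsto_const_nhds.add_atTop tendsto_natCast_atTop_atTop)
      have h := (continuous_real_toNNReal.tendsto 0).comp this
      rwa [Real.toNNReal_zero] at h)
    (fun k => isCompact_closedBall _ _) (Or.inl inferInstance)
  have hmem : ∀ n, ν n ∈ {μ : FiniteMeasure E3 | μ.mass ≤ C.toNNReal ∧
      ∀ k : ℕ, μ (Metric.closedBall (0 : E3) k)ᶜ ≤ (C / (1 + k)).toNNReal} := fun n => by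
    refine ⟨?_, fun k => ?_⟩
    · rw [← ENNReal.coe_le_coe, FiniteMeasure.ennreal_mass]
      exact hν'univ n
    · rw [← ENNReal.coe_le_coe, FiniteMeasure.ennreal_coeFn_eq_coeFn_toMeasure]
      exact hν'tail n k
  let U : Ultrafilter ℕ := Ultrafilter.of atTop
  obtain ⟨νlim, -, hlim⟩ := isCompact_iff_ultrafilter_le_nhds.1 hcomp (U.map ν)
    (le_principal_iff.2 (Ultrafilter.mem_map.2 (univ_mem' hmem)))
  have hlim' : Tendsto ν U (𝓝 νlim) := hlim
  rw [FiniteMeasure.tendsto_iff_forall_integral_rclike_tendsto ℂ] at hlim'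
  have hinvm : Measurable fun x => ENNReal.ofReal (d x)⁻¹ := by
    have := hdc.measurable
    fun_prop
  have htest : ∀ f : E3 → ℂ, Continuous f → ∀ K : ℝ, (∀ x, ‖f x‖ ≤ K * d x) →
      Integrable f ((νlim : Measure E3).withDensity fun x => ENNReal.ofReal (d x)⁻¹) ∧
      Tendsto (fun n => ∫ x, f x ∂(μn n)) U
        (𝓝 (∫ x, f x ∂((νlim : Measure E3).withDensity fun x => ENNReal.ofReal (d x)⁻¹))) := by
    intro f hf K hfK
    have hgc : Continuous fun x => (d x)⁻¹ • f x := (hdc.inv₀ fun x => (hdpos x).ne').smul hf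
    have hgb : ∀ x, ‖(d x)⁻¹ • f x‖ ≤ K := fun x => by
      rw [norm_smul, norm_inv, Real.norm_of_nonneg (hdpos x).le, inv_mul_le_iff₀ (hdpos x),
        mul_comm]
      exact hfK x
    let g := BoundedContinuousFunction.ofNormedAddCommGroup (fun x => (d x)⁻¹ • f x) hgc K hgb
    have hint : Integrable (fun x => (d x)⁻¹ • f x) (νlim : Measure E3) := g.integrable _
    constructor
    · rw [integrable_withDensity_iff_integrable_smul' hinvm (by simp)]
      refine hint.congr (Eventually.of_forall fun x => ?_)
      simp only
      rw [ENNReal.toReal_ofReal (inv_nonneg.2 (hdpos x).le)]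
    · rw [integral_withDensity_eq_integral_toReal_smul hinvm (by simp)]
      refine (hlim' g).congr (fun n => ?_) |>.trans (le_of_eq ?_)
      · change ∫ x, (d x)⁻¹ • f x ∂(ν' n) = _
        rw [integral_withDensity_eq_integral_toReal_smul
          (by have := hdc.measurable; fun_prop) (by simp)]
        refine integral_congr_ae (Eventually.of_forall fun x => ?_)
        simp only
        rw [ENNReal.toReal_ofReal (hdpos x).le, smul_inv_smul₀ (hdpos x).ne']
      · congr 1
        refine integral_congr_ae (Eventually.of_forall fun x => ?_)
        simp only
        rw [ENNReal.toReal_ofReal (inv_nonneg.2 (hdpos x).le)]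
        rfl
  refine ⟨_, ⟨fun L hL => ?_⟩, U, Ultrafilter.of_le _, htest⟩
  rw [withDensity_apply _ hL.measurableSet]
  have hcont : ContinuousOn (fun x => (d x)⁻¹) L :=
    (hdc.inv₀ fun x => (hdpos x).ne').continuousOn
  exact (hcont.integrableOn_compact hL).lintegral_lt_top

end VagueLimit

/-! ### The finite diffraction measures -/

/-- The exponential sum `∑ e^{-2πi⟨ξ, x⟩}` over a finite set of points `x`. -/
noncomputable def expSum (s : Finset E3) (ξ : E3) : ℂ := ∑ x ∈ s, (𝐞 (-inner ℝ ξ x) : ℂ)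

lemma continuous_expSum (s : Finset E3) : Continuous (expSum s) := by
  unfold expSum
  have := Real.continuous_fourierChar
  fun_prop

lemma norm_expSum_le (s : Finset E3) (ξ : E3) : ‖expSum s ξ‖ ≤ s.card := by
  refine (norm_sum_le _ _).trans (le_of_eq ?_)
  rw [Finset.sum_congr rfl fun x _ => Circle.norm_coe _]
  simp

lemma norm_expSum_sq (s : Finset E3) (ξ : E3) :
    ((‖expSum s ξ‖ ^ 2 : ℝ) : ℂ) = ∑ x ∈ s, ∑ y ∈ s, (𝐞 (-inner ℝ ξ (x - y)) : ℂ) := by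
  rw [Complex.ofReal_pow, ← Complex.mul_conj', expSum, map_sum, Finset.sum_mul_sum]
  refine Finset.sum_congr rfl fun x _ => Finset.sum_congr rfl fun y _ => ?_
  rw [← Circle.coe_inv_eq_conj, ← AddChar.map_neg_eq_inv, ← Circle.coe_mul,
    ← AddChar.map_add_eq_mul, inner_sub_right]
  congr 2
  ring

/-- The Fourier transform of the finite autocorrelation. -/
noncomputable def finiteDiffraction (Λ : Set E3) (r : ℝ) : Measure E3 :=
  volume.withDensity fun ξ => ENNReal.ofReal ((r ^ 3)⁻¹ * ‖expSum (patch Λ r) ξ‖ ^ 2)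

lemma integral_finiteDiffraction (Λ : Set E3) {r : ℝ} (hr : 0 ≤ r) {g : E3 → ℂ}
    (hg : Integrable g) : Integrable g (finiteDiffraction Λ r) ∧
      ∫ ξ, g ξ ∂(finiteDiffraction Λ r) =
        (r ^ 3)⁻¹ • ∑ x ∈ patch Λ r, ∑ y ∈ patch Λ r, 𝓕 g (x - y) := by
  have hm : Measurable fun ξ =>
      ENNReal.ofReal ((r ^ 3)⁻¹ * ‖expSum (patch Λ r) ξ‖ ^ 2) := by
    have := (continuous_expSum (patch Λ r)).measurable
    fun_prop
  have hnn : ∀ ξ, 0 ≤ (r ^ 3)⁻¹ * ‖expSum (patch Λ r) ξ‖ ^ 2 := fun ξ => by positivity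
  rw [finiteDiffraction]
  constructor
  · rw [integrable_withDensity_iff_integrable_smul' hm (by simp)]
    simp_rw [ENNReal.toReal_ofReal (hnn _), Complex.real_smul]
    refine hg.bdd_mul (c := (r ^ 3)⁻¹ * (patch Λ r).card ^ 2) ?_ (Eventually.of_forall fun ξ => ?_)
    · have := continuous_expSum (patch Λ r)
      exact Continuous.aestronglyMeasurable (by fun_prop)
    · rw [Complex.norm_real, Real.norm_of_nonneg (hnn ξ)]
      gcongr
      exact norm_expSum_le _ _
  · rw [integral_withDensity_eq_integral_toReal_smul hm (by simp)]
    simp_rw [ENNReal.toReal_ofReal (hnn _), mul_smul]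
    rw [integral_smul]
    congr 1
    have hi : ∀ w : E3, Integrable fun ξ => (𝐞 (-inner ℝ ξ w) : ℂ) * g ξ := fun w => by
      refine hg.bdd_mul (c := 1) ?_ (Eventually.of_forall fun ξ => (Circle.norm_coe _).le)
      have := Real.continuous_fourierChar
      exact Continuous.aestronglyMeasurable (by fun_prop)
    simp_rw [← Complex.coe_smul, norm_expSum_sq, smul_eq_mul, Finset.sum_mul]
    rw [integral_finsetSum _ fun x _ => integrable_finsetSum _ fun y _ => hi _]
    refine Finset.sum_congr rfl fun x _ => ?_
    rw [integral_finsetSum _ fun y _ => hi _]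
    refine Finset.sum_congr rfl fun y _ => ?_
    rw [Real.fourier_eq]
    rfl

/-- The Gaussian `e^{-π ‖ξ‖² / t²}`. -/
noncomputable def gaussian (t : ℝ) (ξ : E3) : ℝ := Real.exp (-(Real.pi / t ^ 2) * ‖ξ‖ ^ 2)

lemma integrable_gaussian {t : ℝ} (ht : 0 < t) : Integrable (fun ξ => (gaussian t ξ : ℂ)) := by
  have h := GaussianFourier.integrable_cexp_neg_mul_sq_norm_add (V := E3)
    (b := ((Real.pi / t ^ 2 : ℝ) : ℂ)) (by rw [Complex.ofReal_re]; positivity) 0 0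
  refine h.congr (Eventually.of_forall fun ξ => ?_)
  simp [gaussian]

lemma exp_le_weight (w : E3) : Real.exp (-(Real.pi * ‖w‖ ^ 2)) ≤ 4 * weight w := by
  rw [Real.exp_neg, weight, ← div_eq_mul_inv, inv_eq_one_div,
    div_le_div_iff₀ (Real.exp_pos _) (by positivity), one_mul]
  have h1 : 1 + ‖w‖ ^ 2 ≤ Real.exp (‖w‖ ^ 2) := by linarith [Real.add_one_le_exp (‖w‖ ^ 2)]
  have h2 : Real.exp (‖w‖ ^ 2) ^ 2 ≤ Real.exp (Real.pi * ‖w‖ ^ 2) := by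
    rw [← Real.exp_nat_mul]
    gcongr
    exact_mod_cast Real.two_le_pi
  have h3 : (1 + ‖w‖) ^ 2 ≤ 2 * (1 + ‖w‖ ^ 2) := by nlinarith [sq_nonneg (1 - ‖w‖)]
  calc (1 + ‖w‖) ^ 4 = ((1 + ‖w‖) ^ 2) ^ 2 := by ring
    _ ≤ (2 * (1 + ‖w‖ ^ 2)) ^ 2 := by gcongr
    _ = 4 * (1 + ‖w‖ ^ 2) ^ 2 := by ring
    _ ≤ 4 * Real.exp (‖w‖ ^ 2) ^ 2 := by gcongr
    _ ≤ _ := by gcongr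

lemma norm_fourier_gaussian_le {t : ℝ} (ht : 1 ≤ t) (w : E3) :
    ‖𝓕 (fun ξ => (gaussian t ξ : ℂ)) w‖ ≤ t ^ 3 * (4 * weight w) := by
  have ht0 : 0 < t := by linarith
  have hpi := Real.pi_pos
  have hfun : (fun ξ => (gaussian t ξ : ℂ)) =
      fun v : E3 => Complex.exp (-((Real.pi / t ^ 2 : ℝ) : ℂ) * ‖v‖ ^ 2) := by
    ext ξ
    simp [gaussian]
  rw [hfun, fourier_gaussian_innerProductSpace (by rw [Complex.ofReal_re]; positivity), norm_mul]
  have h1 : ‖((Real.pi : ℂ) / ((Real.pi / t ^ 2 : ℝ) : ℂ)) ^ ((Module.finrank ℝ E3 : ℂ) / 2)‖ =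
      t ^ 3 := by
    rw [← Complex.ofReal_div, Complex.norm_cpow_eq_rpow_re_of_pos (by positivity),
      div_div_cancel₀ hpi.ne']
    rw [← Real.rpow_natCast, ← Real.rpow_natCast, ← Real.rpow_mul ht0.le]
    congr 1
    simp
    norm_num
  have h2 : ‖Complex.exp (-(Real.pi : ℂ) ^ 2 * ‖w‖ ^ 2 / ((Real.pi / t ^ 2 : ℝ) : ℂ))‖ ≤
      4 * weight w := by
    have : -(Real.pi : ℂ) ^ 2 * ‖w‖ ^ 2 / ((Real.pi / t ^ 2 : ℝ) : ℂ) =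
        ((-(t ^ 2 * (Real.pi * ‖w‖ ^ 2)) : ℝ) : ℂ) := by
      have h3 : (t : ℂ) ≠ 0 := by exact_mod_cast ht0.ne'
      have h4 : (Real.pi : ℂ) ≠ 0 := by exact_mod_cast hpi.ne'
      push_cast
      field_simp
    rw [this, Complex.norm_exp, Complex.ofReal_re]
    refine le_trans ?_ (exp_le_weight w)
    exact Real.exp_le_exp.2 (neg_le_neg
      (le_mul_of_one_le_left (by positivity) (one_le_pow₀ ht)))
  rw [h1]
  gcongr

/-- The weight is dominated by a series of Gaussians of widths `2 ^ k`: the term with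
`2 ^ k ≤ 1 + ‖ξ‖ < 2 ^ (k + 1)` suffices. -/
lemma exists_weight_le_gaussian (ξ : E3) :
    ∃ k : ℕ, weight ξ ≤ Real.exp (4 * Real.pi) * (16⁻¹ ^ k * gaussian (2 ^ k) ξ) := by
  obtain ⟨k, hk1, hk2⟩ := exists_nat_pow_near (x := 1 + ‖ξ‖) (y := 2)
    (by linarith [norm_nonneg ξ]) (by norm_num)
  refine ⟨k, ?_⟩
  have h1 : weight ξ ≤ 16⁻¹ ^ k := by
    rw [weight, inv_pow]
    gcongr
    calc (16 : ℝ) ^ k = (2 ^ k) ^ 4 := by rw [← pow_mul, mul_comm, pow_mul]; norm_num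
      _ ≤ _ := by gcongr
  have h2 : Real.exp (-(4 * Real.pi)) ≤ gaussian (2 ^ k) ξ := by
    rw [gaussian]
    gcongr
    have hpi := Real.pi_pos
    rw [neg_mul, neg_le_neg_iff, div_mul_eq_mul_div, div_le_iff₀ (by positivity)]
    have : ‖ξ‖ ^ 2 ≤ (2 ^ k * 2) ^ 2 := by
      rw [← pow_succ]
      gcongr
      linarith
    calc Real.pi * ‖ξ‖ ^ 2 ≤ Real.pi * (2 ^ k * 2) ^ 2 := by gcongr
      _ = _ := by ring
  have h3 : 1 ≤ Real.exp (4 * Real.pi) * gaussian (2 ^ k) ξ := by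
    calc 1 = Real.exp (4 * Real.pi) * Real.exp (-(4 * Real.pi)) := by
          rw [← Real.exp_add, add_neg_cancel, Real.exp_zero]
      _ ≤ _ := by gcongr
  calc weight ξ ≤ 16⁻¹ ^ k * 1 := by rw [mul_one]; exact h1
    _ ≤ 16⁻¹ ^ k * (Real.exp (4 * Real.pi) * gaussian (2 ^ k) ξ) := by gcongr
    _ = _ := by ring

namespace UniformlyDiscrete

variable {Λ : Set E3}

lemma exists_lintegral_gaussian_le (hΛ : UniformlyDiscrete Λ) :
    ∃ C : ℝ, 0 ≤ C ∧ ∀ r : ℝ, 1 ≤ r → ∀ t : ℝ, 1 ≤ t →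
      ∫⁻ ξ, ENNReal.ofReal (gaussian t ξ) ∂(finiteDiffraction Λ r) ≤
        ENNReal.ofReal (C * t ^ 3) := by
  obtain ⟨C, hC, h⟩ := hΛ.exists_integral_weight_le
  refine ⟨4 * C, by positivity, fun r hr t ht => ?_⟩
  have hr0 : 0 ≤ r := by linarith
  have hnn : ∀ ξ, 0 ≤ gaussian t ξ := fun ξ => (Real.exp_pos _).le
  obtain ⟨hi, heq⟩ := integral_finiteDiffraction Λ hr0 (integrable_gaussian (t := t) (by linarith))
  have hir : Integrable (gaussian t) (finiteDiffraction Λ r) := by simpa using hi.re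
  rw [← ofReal_integral_eq_lintegral_ofReal hir (Eventually.of_forall hnn)]
  refine ENNReal.ofReal_le_ofReal ?_
  have h1 := h r hr
  rw [(hΛ.integral_finiteAutocorrelation hr0 _).2, smul_eq_mul] at h1
  calc ∫ ξ, gaussian t ξ ∂(finiteDiffraction Λ r)
      = ‖∫ ξ, (gaussian t ξ : ℂ) ∂(finiteDiffraction Λ r)‖ := by
        rw [integral_complex_ofReal, Complex.norm_real, Real.norm_of_nonneg (integral_nonneg hnn)]
    _ ≤ (r ^ 3)⁻¹ * ∑ x ∈ patch Λ r, ∑ y ∈ patch Λ r, t ^ 3 * (4 * weight (x - y)) := by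
        rw [heq, norm_smul, Real.norm_of_nonneg (by positivity)]
        gcongr
        refine (norm_sum_le _ _).trans (Finset.sum_le_sum fun x _ => ?_)
        exact (norm_sum_le _ _).trans (Finset.sum_le_sum fun y _ => norm_fourier_gaussian_le ht _)
    _ = 4 * t ^ 3 * ((r ^ 3)⁻¹ * ∑ x ∈ patch Λ r, ∑ y ∈ patch Λ r, weight (x - y)) := by
        simp_rw [← Finset.mul_sum]
        ring
    _ ≤ 4 * t ^ 3 * C := by gcongr
    _ = _ := by ring

/-- The finite diffraction measures are uniformly bounded on the weight. -/
lemma exists_integral_weight_finiteDiffraction_le (hΛ : UniformlyDiscrete Λ) :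
    ∃ C : ℝ, ∀ r : ℝ, 1 ≤ r → Integrable weight (finiteDiffraction Λ r) ∧
      ∫ ξ, weight ξ ∂(finiteDiffraction Λ r) ≤ C := by
  obtain ⟨C, hC, h⟩ := hΛ.exists_lintegral_gaussian_le
  set A := Real.exp (4 * Real.pi) with hA
  have hApos : 0 < A := Real.exp_pos _
  refine ⟨A * C * 2, fun r hr => ?_⟩
  have hgm : ∀ t, Measurable (gaussian t) := fun t => by unfold gaussian; fun_prop
  have hsum : HasSum (fun k : ℕ => A * C * (1 / 2) ^ k) (A * C * 2) :=
    hasSum_geometric_two.mul_left _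
  have hl : ∫⁻ ξ, ENNReal.ofReal (weight ξ) ∂(finiteDiffraction Λ r) ≤
      ENNReal.ofReal (A * C * 2) := by
    calc ∫⁻ ξ, ENNReal.ofReal (weight ξ) ∂(finiteDiffraction Λ r)
        ≤ ∫⁻ ξ, ∑' k : ℕ, ENNReal.ofReal (A * 16⁻¹ ^ k) * ENNReal.ofReal (gaussian (2 ^ k) ξ)
            ∂(finiteDiffraction Λ r) := by
          refine lintegral_mono fun ξ => ?_
          obtain ⟨k, hk⟩ := exists_weight_le_gaussian ξ
          refine le_trans ?_ (ENNReal.le_tsum k)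
          rw [← ENNReal.ofReal_mul (by positivity), mul_assoc]
          exact ENNReal.ofReal_le_ofReal hk
      _ = ∑' k : ℕ, ENNReal.ofReal (A * 16⁻¹ ^ k) *
            ∫⁻ ξ, ENNReal.ofReal (gaussian (2 ^ k) ξ) ∂(finiteDiffraction Λ r) := by
          rw [lintegral_tsum fun k =>
            ((hgm _).ennreal_ofReal.const_mul _).aemeasurable]
          simp_rw [lintegral_const_mul _ (hgm _).ennreal_ofReal]
      _ ≤ ∑' k : ℕ, ENNReal.ofReal (A * C * (1 / 2) ^ k) := by
          refine ENNReal.tsum_le_tsum fun k => ?_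
          refine (mul_le_mul_right (h r hr (2 ^ k) (one_le_pow₀ (by norm_num))) _).trans_eq ?_
          rw [← ENNReal.ofReal_mul (by positivity)]
          congr 1
          have : ((2 : ℝ) ^ k) ^ 3 = 8 ^ k := by rw [← pow_mul, mul_comm, pow_mul]; norm_num
          rw [this, show (1 / 2 : ℝ) = 16⁻¹ * 8 by norm_num, mul_pow]
          ring
      _ = ENNReal.ofReal (A * C * 2) := by
          rw [← ENNReal.ofReal_tsum_of_nonneg (fun k => by positivity) hsum.summable,
            hsum.tsum_eq]
  have hint : Integrable weight (finiteDiffraction Λ r) := by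
    refine ⟨continuous_weight.aestronglyMeasurable, ?_⟩
    rw [hasFiniteIntegral_iff_ofReal (Eventually.of_forall fun x => (weight_pos x).le)]
    exact hl.trans_lt ENNReal.ofReal_lt_top
  refine ⟨hint, ?_⟩
  rw [← ENNReal.ofReal_le_ofReal_iff (by positivity),
    ofReal_integral_eq_lintegral_ofReal hint (Eventually.of_forall fun x => (weight_pos x).le)]
  exact hl

/-- The radii of an autocorrelation may be taken to be at least `1`. -/
lemma exists_radii {γ : Measure E3} (hγ : IsAutocorrelation Λ γ) :
    ∃ r : ℕ → ℝ, (∀ n, 1 ≤ r n) ∧ Tendsto r atTop atTop ∧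
      ∀ f : E3 → ℝ, Continuous f → HasCompactSupport f →
        Tendsto (fun n => ∫ x, f x ∂(finiteAutocorrelation Λ (r n))) atTop (𝓝 (∫ x, f x ∂γ)) := by
  obtain ⟨-, r, hr, hv⟩ := hγ
  obtain ⟨N, hN⟩ := eventually_atTop.1 (hr.eventually_ge_atTop 1)
  refine ⟨fun n => r (n + N), fun n => hN _ (Nat.le_add_left N n),
    hr.comp (tendsto_add_atTop_nat N), fun f hf hf' => ?_⟩
  exact (hv f hf hf').comp (tendsto_add_atTop_nat N)

/-- An autocorrelation is a tempered measure, and its values on Schwartz functions are the limits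
of those of the finite autocorrelations. -/
lemma integral_schwartz_of_isAutocorrelation (hΛ : UniformlyDiscrete Λ) {γ : Measure E3}
    [IsFiniteMeasureOnCompacts γ] {r : ℕ → ℝ} (hr : ∀ n, 1 ≤ r n)
    (hv : ∀ f : E3 → ℝ, Continuous f → HasCompactSupport f →
      Tendsto (fun n => ∫ x, f x ∂(finiteAutocorrelation Λ (r n))) atTop (𝓝 (∫ x, f x ∂γ)))
    (f : 𝓢(E3, ℂ)) : Integrable (fun x => f x) γ ∧
      Tendsto (fun n => ((r n) ^ 3)⁻¹ • ∑ x ∈ patch Λ (r n), ∑ y ∈ patch Λ (r n), f (x - y))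
        atTop (𝓝 (∫ x, f x ∂γ)) := by
  obtain ⟨C, -, hC⟩ := hΛ.exists_integral_weight_le
  obtain ⟨K, hK, hfK⟩ := f.exists_norm_le_weight 1
  simp only [pow_one] at hfK
  have hr0 : ∀ n, 0 ≤ r n := fun n => zero_le_one.trans (hr n)
  have hw : ∀ n, Integrable weight (finiteAutocorrelation Λ (r n)) := fun n =>
    (hΛ.integral_finiteAutocorrelation (hr0 n) _).1
  have hb := fun n => hC (r n) (hr n)
  refine ⟨integrable_of_le_weight (integrable_weight_of_vague hw hb hv).1
    f.continuous.aestronglyMeasurable hK hfK, ?_⟩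
  refine (tendsto_integral_complex_of_vague hw hb hv f.continuous hK hfK).congr fun n => ?_
  exact (hΛ.integral_finiteAutocorrelation (hr0 n) _).2

/-- Every autocorrelation of a uniformly discrete set is Fourier transformable, with a positive
measure as its transform. -/
lemma exists_isFourierTransform (hΛ : UniformlyDiscrete Λ) {γ : Measure E3}
    (hγ : IsAutocorrelation Λ γ) : ∃ μ, IsFourierTransform γ μ := by
  have := hγ.1
  obtain ⟨r, hr, -, hv⟩ := exists_radii hγ
  obtain ⟨C, hC⟩ := hΛ.exists_integral_weight_finiteDiffraction_le
  obtain ⟨μ, hμ, U, hU, h⟩ := exists_limit_of_integral_weight_le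
    (μn := fun n => finiteDiffraction Λ (r n)) (fun n => (hC _ (hr n)).1) fun n => (hC _ (hr n)).2
  refine ⟨μ, hμ, fun f => ?_⟩
  obtain ⟨K, -, hfK⟩ := f.exists_norm_le_weight 1
  simp only [pow_one] at hfK
  obtain ⟨h1, h2⟩ := h f f.continuous K hfK
  obtain ⟨h3, h4⟩ := hΛ.integral_schwartz_of_isAutocorrelation hr hv (𝓕 f)
  refine ⟨h1, h3, tendsto_nhds_unique h2 ((h4.mono_left hU).congr fun n => ?_)⟩
  rw [(integral_finiteDiffraction Λ (zero_le_one.trans (hr n)) f.integrable).2]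
  simp_rw [← SchwartzMap.fourier_coe]

end UniformlyDiscrete

/-! ### Measures are determined by smooth test functions -/

lemma exists_smooth_bump {K U : Set E3} (hK : IsCompact K) (hU : IsOpen U) (hKU : K ⊆ U) :
    ∃ f : E3 → ℝ, ContDiff ℝ (⊤ : ℕ∞) f ∧ HasCompactSupport f ∧ tsupport f ⊆ U ∧
      (∀ x, 0 ≤ f x ∧ f x ≤ 1) ∧ ∀ x ∈ K, f x = 1 := by
  obtain ⟨δ, hδ, hδU⟩ := hK.exists_cthickening_subset_open hU hKU
  obtain ⟨f, hf, hrange, hsupp, hone⟩ := exists_contMDiff_support_eq_eq_one_iff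
    (n := (⊤ : ℕ∞)) (modelWithCornersSelf ℝ E3)
    (Metric.isOpen_thickening (δ := δ) (E := K)) hK.isClosed (Metric.self_subset_thickening hδ K)
  have hts : tsupport f ⊆ Metric.cthickening δ K := by
    rw [tsupport, hsupp]
    exact Metric.closure_thickening_subset_cthickening δ K
  exact ⟨f, hf.contDiff, hK.cthickening.of_isClosed_subset (isClosed_tsupport f) hts,
    hts.trans hδU, fun x => hrange (mem_range_self x), fun x hx => (hone x).1 hx⟩

/-- A smooth compactly supported real function as a complex Schwartz function. -/
noncomputable def toSchwartz {f : E3 → ℝ} (hf : ContDiff ℝ (⊤ : ℕ∞) f)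
    (hc : HasCompactSupport f) : 𝓢(E3, ℂ) :=
  HasCompactSupport.toSchwartzMap (f := fun x => (f x : ℂ))
    (hc.comp_left (g := fun t : ℝ => (t : ℂ)) Complex.ofReal_zero)
    (Complex.ofRealCLM.contDiff.comp hf)

lemma measure_le_integral_of_one_le {μ : Measure E3} [IsFiniteMeasureOnCompacts μ] {K : Set E3}
    (hK : IsCompact K) {f : E3 → ℝ} (hf : Continuous f) (hc : HasCompactSupport f)
    (hnn : ∀ x, 0 ≤ f x) (hone : ∀ x ∈ K, f x = 1) : μ K ≤ ENNReal.ofReal (∫ x, f x ∂μ) := by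
  rw [ofReal_integral_eq_lintegral_ofReal (hf.integrable_of_hasCompactSupport hc)
    (Eventually.of_forall hnn), ← lintegral_indicator_one hK.measurableSet]
  refine lintegral_mono fun x => ?_
  by_cases hx : x ∈ K
  · simp [hx, hone x hx]
  · simp [hx]

lemma measure_le_of_forall_schwartz {μ ν : Measure E3} [IsFiniteMeasureOnCompacts μ]
    [IsFiniteMeasureOnCompacts ν] (h : ∀ f : 𝓢(E3, ℂ), ∫ x, f x ∂μ = ∫ x, f x ∂ν) {K : Set E3}
    (hK : IsCompact K) : μ K ≤ ν K := by
  rw [K.measure_eq_iInf_isOpen ν]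
  refine le_iInf₂ fun U hKU => le_iInf fun hU => ?_
  obtain ⟨f, hf, hc, hsupp, h01, hone⟩ := exists_smooth_bump hK hU hKU
  have heq : ∫ x, f x ∂μ = ∫ x, f x ∂ν := by
    have := h (toSchwartz hf hc)
    change ∫ x, (f x : ℂ) ∂μ = ∫ x, (f x : ℂ) ∂ν at this
    rw [integral_complex_ofReal, integral_complex_ofReal] at this
    exact_mod_cast this
  refine (measure_le_integral_of_one_le hK hf.continuous hc (fun x => (h01 x).1) hone).trans ?_
  rw [heq, ofReal_integral_eq_lintegral_ofReal (hf.continuous.integrable_of_hasCompactSupport hc)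
    (Eventually.of_forall fun x => (h01 x).1), ← lintegral_indicator_one hU.measurableSet]
  refine lintegral_mono fun x => ?_
  by_cases hx : x ∈ U
  · simpa [hx] using (h01 x).2
  · have : f x = 0 := by
      by_contra h0
      exact hx (hsupp (subset_tsupport f h0))
    simp [hx, this]

lemma measure_eq_of_forall_schwartz {μ ν : Measure E3} [IsFiniteMeasureOnCompacts μ]
    [IsFiniteMeasureOnCompacts ν] (h : ∀ f : 𝓢(E3, ℂ), ∫ x, f x ∂μ = ∫ x, f x ∂ν) : μ = ν := by
  have hK : ∀ K : Set E3, IsCompact K → μ K = ν K := fun K hK =>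
    le_antisymm (measure_le_of_forall_schwartz h hK)
      (measure_le_of_forall_schwartz (fun f => (h f).symm) hK)
  have hU : ∀ U : Set E3, IsOpen U → μ U = ν U := fun U hU => by
    rw [hU.measure_eq_iSup_isCompact μ, hU.measure_eq_iSup_isCompact ν]
    exact iSup_congr fun K => iSup_congr fun _ => iSup_congr fun hc => hK K hc
  ext s -
  rw [s.measure_eq_iInf_isOpen μ, s.measure_eq_iInf_isOpen ν]
  exact iInf_congr fun U => iInf_congr fun _ => iInf_congr fun ho => hU U ho

/-- A measure that annihilates the smooth test functions supported in an open set does not charge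
this set. -/
lemma measure_eq_zero_of_forall_smooth {μ : Measure E3} [IsFiniteMeasureOnCompacts μ] {U : Set E3}
    (hU : IsOpen U) (h : ∀ f : E3 → ℝ, ContDiff ℝ (⊤ : ℕ∞) f → HasCompactSupport f →
      tsupport f ⊆ U → ∫ x, f x ∂μ = 0) : μ U = 0 := by
  rw [hU.measure_eq_iSup_isCompact μ]
  simp only [ENNReal.iSup_eq_zero]
  intro K hKU hK
  obtain ⟨f, hf, hc, hsupp, h01, hone⟩ := exists_smooth_bump hK hU hKU
  have := measure_le_integral_of_one_le (μ := μ) hK hf.continuous hc (fun x => (h01 x).1) hone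
  rw [h f hf hc hsupp] at this
  simpa using this

/-! ### Sums over a uniformly discrete set that cancel -/

namespace UniformlyDiscrete

variable {Λ : Set E3}

lemma summable_comp_sub (hΛ : UniformlyDiscrete Λ) {g : E3 → ℂ} {K : ℝ}
    (hg : ∀ x, ‖g x‖ ≤ K * weight x) (u : E3) : Summable fun x : Λ => g (x - u) := by
  obtain ⟨C, -, h⟩ := hΛ.exists_tsum_weight_le
  exact Summable.of_norm_bounded ((h u).1.mul_left K) fun x => hg _

lemma summable_schwartz (hΛ : UniformlyDiscrete Λ) (g : 𝓢(E3, ℂ)) (u : E3) :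
    Summable fun x : Λ => g (x - u) := by
  obtain ⟨K, -, h⟩ := g.exists_norm_le_weight 0
  exact hΛ.summable_comp_sub (by simpa using h) u

/-- If the sum over `Λ` vanishes, then the sum over the part of `Λ` in a cube is controlled by the
terms outside of the cube. -/
lemma norm_sum_patch_le {C : ℝ} (hΛ : UniformlyDiscrete Λ) {u : E3}
    (hC : Summable (fun x : Λ => weight (x - u)) ∧ ∑' x : Λ, weight (x - u) ≤ C)
    {g : E3 → ℂ} (hs : Summable fun x : Λ => g (x - u)) (h0 : ∑' x : Λ, g (x - u) = 0) {r q : ℝ}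
    (hq : 0 ≤ q) (hg : ∀ x, x ∉ cube r → ‖g (x - u)‖ ≤ q * weight (x - u)) :
    ‖∑ x ∈ patch Λ r, g (x - u)‖ ≤ q * C := by
  classical
  set S : Finset Λ := (patch Λ r).subtype (· ∈ Λ) with hS
  have hsum : ∑ x ∈ patch Λ r, g (x - u) = ∑ x ∈ S, g (x - u) :=
    (Finset.sum_subtype_of_mem (fun x => g (x - u)) fun x hx => hΛ.patch_subset r hx).symm
  have h1 := hs.sum_add_tsum_compl (s := S)
  rw [h0] at h1
  rw [hsum, eq_neg_of_add_eq_zero_left h1, norm_neg]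
  have hw : Summable fun x : ((S : Set Λ)ᶜ : Set Λ) => q * weight (x - u) :=
    (hC.1.mul_left q).subtype _
  refine (tsum_of_norm_bounded hw.hasSum fun x => hg _ fun hx => x.2 ?_).trans ?_
  · exact Finset.mem_subtype.2 (hΛ.mem_patch.2 ⟨x.1.2, hx⟩)
  · rw [tsum_mul_left]
    gcongr
    exact (hC.1.tsum_subtype_le (fun x : Λ => weight (x - u)) _
      fun x => (weight_pos _).le).trans hC.2

/-- If the sums of `g` over all translates of `Λ` vanish, then only pairs of points near the
boundary contribute to the double sums over `Λ ∩ C_r`, and their means tend to `0`. -/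
lemma tendsto_sum_patch_zero (hΛ : UniformlyDiscrete Λ) {g : E3 → ℂ} {K : ℝ} (hK : 0 ≤ K)
    (hg : ∀ x, ‖g x‖ ≤ K * (weight x / (1 + ‖x‖))) (h0 : ∀ u, ∑' x : Λ, g (x - u) = 0) :
    Tendsto (fun r : ℝ => (r ^ 3)⁻¹ • ∑ x ∈ patch Λ r, ∑ y ∈ patch Λ r, g (x - y)) atTop
      (𝓝 0) := by
  classical
  obtain ⟨C, hC0, hC⟩ := hΛ.exists_tsum_weight_le
  obtain ⟨D, hD0, hD⟩ := hΛ.exists_card_patch_le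
  have hgw : ∀ x, ‖g x‖ ≤ K * weight x := fun x => by
    simpa using abs_le_weight_of_le (f := fun x => ‖g x‖) hK (by simpa using hg) x
  have hbound : ∀ s : ℝ, 0 ≤ s → ∀ r : ℝ, 1 ≤ r →
      ‖(r ^ 3)⁻¹ • ∑ x ∈ patch Λ r, ∑ y ∈ patch Λ r, g (x - y)‖ ≤ D * (K * C / (1 + s)) +
        (r ^ 3)⁻¹ * (patch Λ r \ patch Λ (r - 2 * s)).card * (K * C) := by
    intro s hs r hr
    have hpt : ∀ y ∈ patch Λ r, ‖∑ x ∈ patch Λ r, g (x - y)‖ ≤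
        K * C / (1 + s) + if y ∉ patch Λ (r - 2 * s) then K * C else 0 := fun y hy => by
      have hsy := hΛ.summable_comp_sub hgw y
      split_ifs with hys
      · rw [add_zero]
        refine (hΛ.norm_sum_patch_le (hC y) hsy (h0 y) (q := K / (1 + s)) (by positivity)
          fun x hx => ?_).trans_eq (div_mul_eq_mul_div _ _ _)
        have hdist : s ≤ ‖x - y‖ := by
          by_contra! hlt
          refine hx fun i => ?_
          have h1 := (hΛ.mem_patch.1 hys).2 i
          have h2 := abs_apply_le_norm (x - y) i
          have h3 := abs_add_le (y i) ((x - y) i)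
          rw [PiLp.sub_apply] at h2 h3
          rw [add_sub_cancel] at h3
          linarith
        refine (hg _).trans ?_
        rw [div_mul_eq_mul_div, mul_div_assoc]
        have := (weight_pos (x - y)).le
        gcongr
      · refine (hΛ.norm_sum_patch_le (hC y) hsy (h0 y) hK fun x _ => hgw _).trans ?_
        exact le_add_of_nonneg_left (by positivity)
    rw [Finset.sum_comm, norm_smul, Real.norm_of_nonneg (by positivity)]
    calc (r ^ 3)⁻¹ * ‖∑ y ∈ patch Λ r, ∑ x ∈ patch Λ r, g (x - y)‖
        ≤ (r ^ 3)⁻¹ * ∑ y ∈ patch Λ r,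
            (K * C / (1 + s) + if y ∉ patch Λ (r - 2 * s) then K * C else 0) := by
          gcongr
          exact (norm_sum_le _ _).trans (Finset.sum_le_sum hpt)
      _ = (r ^ 3)⁻¹ * (patch Λ r).card * (K * C / (1 + s)) +
            (r ^ 3)⁻¹ * (patch Λ r \ patch Λ (r - 2 * s)).card * (K * C) := by
          rw [Finset.sum_add_distrib, ← Finset.sum_filter, Finset.sum_const, Finset.sum_const,
            nsmul_eq_mul, nsmul_eq_mul, Finset.filter_notMem_eq_sdiff]
          ring
      _ ≤ _ := by
          gcongr
          exact hD r hr
  rw [Metric.tendsto_nhds]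
  intro δ hδ
  have hlim : Tendsto (fun s : ℝ => D * (K * C / (1 + s))) atTop (𝓝 (D * 0)) :=
    (tendsto_const_nhds.div_atTop (tendsto_atTop_add_const_left _ _ tendsto_id)).const_mul D
  rw [mul_zero] at hlim
  obtain ⟨s, hs, hs0⟩ := ((hlim.eventually_lt_const (half_pos hδ)).and
    (eventually_ge_atTop 0)).exists
  have hb := (hΛ.tendsto_card_boundary hs0).mul_const (K * C)
  rw [zero_mul] at hb
  filter_upwards [hb.eventually_lt_const (half_pos hδ), eventually_ge_atTop 1] with r h1 h2
  rw [dist_zero_right]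
  refine (hbound s hs0 r h2).trans_lt ?_
  have h3 : (r ^ 3)⁻¹ * ((patch Λ r \ patch Λ (r - 2 * s)).card : ℝ) * (K * C) < δ / 2 := by
    convert h1
  linarith

end UniformlyDiscrete

/-! ### Sums of Fourier transforms over lattices -/

/-- The function `ξ ↦ e^{2πi⟨ξ, v⟩} - 1`. -/
noncomputable def expSubOne (v ξ : E3) : ℂ := 𝐞 (inner ℝ ξ v) - 1

lemma contDiff_expSubOne (v : E3) : ContDiff ℝ (⊤ : ℕ∞) (expSubOne v) := by
  have : expSubOne v =
      fun ξ => Complex.exp (2 * Real.pi * ((inner ℝ ξ v : ℝ) : ℂ) * Complex.I) - 1 := by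
    ext ξ
    rw [expSubOne, Real.fourierChar_apply]
    push_cast
    rfl
  rw [this]
  have h1 : ContDiff ℝ (⊤ : ℕ∞) fun ξ : E3 => ((inner ℝ ξ v : ℝ) : ℂ) :=
    Complex.ofRealCLM.contDiff.comp (contDiff_id.inner ℝ contDiff_const)
  fun_prop

lemma expSubOne_eq_zero_iff {v ξ : E3} : expSubOne v ξ = 0 ↔ ∃ k : ℤ, inner ℝ ξ v = (k : ℝ) := by
  rw [expSubOne, sub_eq_zero, Real.fourierChar_apply, Complex.exp_eq_one_iff]
  have hpi : (Real.pi : ℂ) ≠ 0 := by exact_mod_cast Real.pi_ne_zero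
  refine exists_congr fun k => ?_
  rw [← Complex.ofReal_inj]
  push_cast
  constructor
  · intro h
    have h2 : (2 * Real.pi * Complex.I) * ((inner ℝ ξ v : ℝ) : ℂ) =
        (2 * Real.pi * Complex.I) * k := by
      linear_combination h
    exact mul_left_cancel₀ (by simp [hpi]) h2
  · intro h
    rw [h]
    ring

lemma integrable_expSubOne_mul (v : E3) (h : 𝓢(E3, ℂ)) :
    Integrable fun ξ => expSubOne v ξ * h ξ := by
  refine h.integrable.bdd_mul (c := 2) (contDiff_expSubOne v).continuous.aestronglyMeasurable
    (Eventually.of_forall fun ξ => ?_)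
  refine (norm_sub_le _ _).trans_eq ?_
  rw [Circle.norm_coe, norm_one]
  norm_num

/-- A test function whose support avoids the common zeros of `e^{2πi⟨ξ, v⟩} - 1` and
`e^{2πi⟨ξ, w⟩} - 1` is a combination of these two functions with smooth coefficients. -/
lemma exists_eq_expSubOne_mul_add (v w : E3) {f : E3 → ℂ} (hf : ContDiff ℝ (⊤ : ℕ∞) f)
    (hc : HasCompactSupport f)
    (hvw : ∀ ξ ∈ tsupport f, ¬ (expSubOne v ξ = 0 ∧ expSubOne w ξ = 0)) :
    ∃ h₁ h₂ : 𝓢(E3, ℂ), ∀ ξ, f ξ = expSubOne v ξ * h₁ ξ + expSubOne w ξ * h₂ ξ := by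
  set D : E3 → ℝ := fun ξ => ‖expSubOne v ξ‖ ^ 2 + ‖expSubOne w ξ‖ ^ 2 with hD
  have hDc : ContDiff ℝ (⊤ : ℕ∞) D :=
    ((contDiff_expSubOne v).norm_sq ℝ).add ((contDiff_expSubOne w).norm_sq ℝ)
  have hD0 : ∀ ξ ∈ tsupport f, D ξ ≠ 0 := fun ξ hξ h0 => hvw ξ hξ <| by
    have := (add_eq_zero_iff_of_nonneg (sq_nonneg ‖expSubOne v ξ‖)
      (sq_nonneg ‖expSubOne w ξ‖)).1 h0
    simpa using this
  -- the coefficients `f · conj E_v / D` and `f · conj E_w / D`, where `D = |E_v|² + |E_w|²`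
  let q : E3 → E3 → ℂ := fun c ξ => (D ξ)⁻¹ • (starRingEnd ℂ (expSubOne c ξ) * f ξ)
  have hqc : ∀ c, ContDiff ℝ (⊤ : ℕ∞) (q c) := fun c => by
    rw [contDiff_iff_contDiffAt]
    intro ξ
    by_cases hξ : ξ ∈ tsupport f
    · exact (hDc.contDiffAt.inv (hD0 ξ hξ)).smul
        ((Complex.conjCLE.contDiff.comp (contDiff_expSubOne _)).mul hf).contDiffAt
    · have : q c =ᶠ[𝓝 ξ] fun _ => 0 := by
        filter_upwards [notMem_tsupport_iff_eventuallyEq.1 hξ] with η hη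
        simp [q, hη]
      exact contDiffAt_const.congr_of_eventuallyEq this
  have hqs : ∀ c, HasCompactSupport (q c) := fun c => by
    have h1 : HasCompactSupport fun ξ => starRingEnd ℂ (expSubOne c ξ) * f ξ := hc.mul_left
    exact h1.smul_left (f := fun ξ => (D ξ)⁻¹)
  refine ⟨(hqs v).toSchwartzMap (hqc v), (hqs w).toSchwartzMap (hqc w), fun ξ => ?_⟩
  rw [HasCompactSupport.toSchwartzMap_toFun, HasCompactSupport.toSchwartzMap_toFun]
  by_cases hξ : ξ ∈ tsupport f
  · have hDξ : (D ξ : ℂ) ≠ 0 := by exact_mod_cast hD0 ξ hξ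
    have hsplit : expSubOne v ξ * q v ξ + expSubOne w ξ * q w ξ = (D ξ : ℂ)⁻¹ *
        (expSubOne v ξ * starRingEnd ℂ (expSubOne v ξ) +
          expSubOne w ξ * starRingEnd ℂ (expSubOne w ξ)) * f ξ := by
      simp only [q, Complex.real_smul, Complex.ofReal_inv]
      ring
    have hDD : expSubOne v ξ * starRingEnd ℂ (expSubOne v ξ) +
        expSubOne w ξ * starRingEnd ℂ (expSubOne w ξ) = (D ξ : ℂ) := by
      rw [Complex.mul_conj', Complex.mul_conj', hD]
      push_cast
      rfl
    rw [hsplit, hDD, inv_mul_cancel₀ hDξ, one_mul]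
  · have : f ξ = 0 := image_eq_zero_of_notMem_tsupport hξ
    simp [q, this]

section Telescope

variable {Γ : Type*} [AddCommGroup Γ] (φ : Γ →+ E3)

/-- The Fourier transform of `(e^{2πi⟨ξ, φ c⟩} - 1) h` is a difference of two translates of `𝓕 h`
by elements of the lattice, so its sum over the lattice telescopes to `0`. -/
lemma tsum_fourier_expSubOne_mul
    (hsum : ∀ (g : 𝓢(E3, ℂ)) (u : E3), Summable fun x : Γ => g (φ x + u)) (c : Γ) (h : 𝓢(E3, ℂ))
    (u : E3) : HasSum (fun x : Γ => 𝓕 (fun ξ => expSubOne (φ c) ξ * h ξ) (φ x + u)) 0 := by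
  have hF : ∀ w, 𝓕 (fun ξ => expSubOne (φ c) ξ * h ξ) w = 𝓕 h (w - φ c) - 𝓕 h w := fun w => by
    rw [SchwartzMap.fourier_coe, Real.fourier_eq, Real.fourier_eq, Real.fourier_eq,
      ← integral_sub ((Real.fourierIntegral_convergent_iff _).2 h.integrable)
        ((Real.fourierIntegral_convergent_iff _).2 h.integrable)]
    refine integral_congr_ae (Eventually.of_forall fun ξ => ?_)
    have he : (𝐞 (-inner ℝ ξ (w - φ c)) : ℂ) = 𝐞 (inner ℝ ξ (φ c)) * 𝐞 (-inner ℝ ξ w) := by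
      rw [← Circle.coe_mul, ← AddChar.map_add_eq_mul, inner_sub_right, neg_sub, sub_eq_add_neg]
    simp only [Circle.smul_def, smul_eq_mul, expSubOne, he]
    ring
  simp_rw [hF]
  have h1 := (hsum (𝓕 h) u).hasSum
  have h2 : HasSum (fun x : Γ => 𝓕 h (φ x + u - φ c)) (∑' x : Γ, 𝓕 h (φ x + u)) := by
    have := (Equiv.subRight c).hasSum_iff.2 h1
    refine this.congr_fun ?_
    intro x
    simp only [Function.comp, Equiv.subRight_apply, map_sub]
    congr 1
    abel
  simpa using h2.sub h1

/-- A substitute for the Poisson summation formula: the sum of `𝓕 f` over a translate of a lattice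
vanishes if the support of `f` avoids the common zeros of `e^{2πi⟨ξ, v⟩} - 1` for two lattice
vectors `v`. -/
lemma tsum_fourier_eq_zero
    (hsum : ∀ (g : 𝓢(E3, ℂ)) (u : E3), Summable fun x : Γ => g (φ x + u)) (a b : Γ) {f : E3 → ℂ}
    (hf : ContDiff ℝ (⊤ : ℕ∞) f) (hc : HasCompactSupport f)
    (hab : ∀ ξ ∈ tsupport f, ¬ (expSubOne (φ a) ξ = 0 ∧ expSubOne (φ b) ξ = 0)) (u : E3) :
    ∑' x : Γ, 𝓕 f (φ x + u) = 0 := by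
  obtain ⟨h₁, h₂, hfab⟩ := exists_eq_expSubOne_mul_add _ _ hf hc hab
  have hF : ∀ w, 𝓕 f w = 𝓕 (fun ξ => expSubOne (φ a) ξ * h₁ ξ) w +
      𝓕 (fun ξ => expSubOne (φ b) ξ * h₂ ξ) w := fun w => by
    rw [Real.fourier_eq, Real.fourier_eq, Real.fourier_eq, ← integral_add
      ((Real.fourierIntegral_convergent_iff _).2 (integrable_expSubOne_mul (φ a) h₁))
      ((Real.fourierIntegral_convergent_iff _).2 (integrable_expSubOne_mul (φ b) h₂))]
    refine integral_congr_ae (Eventually.of_forall fun ξ => ?_)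
    simp only [hfab, smul_add]
  simp_rw [hF]
  simpa using ((tsum_fourier_expSubOne_mul φ hsum a h₁ u).add
    (tsum_fourier_expSubOne_mul φ hsum b h₂ u)).tsum_eq

end Telescope

/-! ### Rotations about the vertical axis -/

lemma inner_eq_sum (x y : E3) : inner ℝ x y = x 0 * y 0 + x 1 * y 1 + x 2 * y 2 := by
  rw [PiLp.inner_apply, Fin.sum_univ_three]
  simp only [RCLike.inner_apply, conj_trivial]
  ring

lemma norm_sq_eq_sum (x : E3) : ‖x‖ ^ 2 = x 0 ^ 2 + x 1 ^ 2 + x 2 ^ 2 := by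
  rw [EuclideanSpace.norm_sq_eq, Fin.sum_univ_three]
  simp

@[simp] lemma axisRot_apply_zero (θ : ℝ) (x : E3) :
    axisRot θ x 0 = Real.cos θ * x 0 - Real.sin θ * x 1 := rfl

@[simp] lemma axisRot_apply_one (θ : ℝ) (x : E3) :
    axisRot θ x 1 = Real.sin θ * x 0 + Real.cos θ * x 1 := rfl

@[simp] lemma axisRot_apply_two (θ : ℝ) (x : E3) : axisRot θ x 2 = x 2 := rfl

lemma E3_ext {x y : E3} (h0 : x 0 = y 0) (h1 : x 1 = y 1) (h2 : x 2 = y 2) : x = y := by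
  ext i
  fin_cases i
  exacts [h0, h1, h2]

lemma axisRot_add (θ : ℝ) (x y : E3) : axisRot θ (x + y) = axisRot θ x + axisRot θ y := by
  refine E3_ext ?_ ?_ ?_ <;> simp only [axisRot_apply_zero, axisRot_apply_one, axisRot_apply_two,
    PiLp.add_apply] <;> ring

lemma axisRot_axisRot (θ η : ℝ) (x : E3) : axisRot θ (axisRot η x) = axisRot (θ + η) x := by
  refine E3_ext ?_ ?_ ?_ <;> simp only [axisRot_apply_zero, axisRot_apply_one, axisRot_apply_two,
    Real.cos_add, Real.sin_add] <;> ring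

lemma axisRot_zero_angle (x : E3) : axisRot 0 x = x := by
  refine E3_ext ?_ ?_ ?_ <;> simp

lemma axisRot_add_int_mul_two_pi (θ : ℝ) (k : ℤ) (x : E3) :
    axisRot (θ + k * (2 * Real.pi)) x = axisRot θ x := by
  refine E3_ext ?_ ?_ ?_ <;> simp [Real.cos_add_int_mul_two_pi, Real.sin_add_int_mul_two_pi]

lemma inner_axisRot_right (θ : ℝ) (x y : E3) :
    inner ℝ x (axisRot θ y) = inner ℝ (axisRot (-θ) x) y := by
  simp only [inner_eq_sum, axisRot_apply_zero, axisRot_apply_one, axisRot_apply_two, Real.cos_neg,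
    Real.sin_neg]
  ring

lemma norm_axisRot (θ : ℝ) (x : E3) : ‖axisRot θ x‖ = ‖x‖ := by
  rw [← sq_eq_sq₀ (norm_nonneg _) (norm_nonneg _), ← real_inner_self_eq_norm_sq,
    inner_axisRot_right, axisRot_axisRot, neg_add_cancel, axisRot_zero_angle,
    real_inner_self_eq_norm_sq]

lemma continuous_axisRot {X : Type*} [TopologicalSpace X] {θ : X → ℝ} {x : X → E3}
    (hθ : Continuous θ) (hx : Continuous x) : Continuous fun t => axisRot (θ t) (x t) := by
  unfold axisRot
  refine (PiLp.continuous_toLp 2 _).comp (continuous_pi fun i => ?_)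
  fin_cases i
  · change Continuous fun t => Real.cos (θ t) * x t 0 - Real.sin (θ t) * x t 1
    fun_prop
  · change Continuous fun t => Real.sin (θ t) * x t 0 + Real.cos (θ t) * x t 1
    fun_prop
  · change Continuous fun t => x t 2
    fun_prop

/-- The rotation about the vertical axis as a homomorphism. -/
noncomputable def axisRotHom (θ : ℝ) : E3 →+ E3 := AddMonoidHom.mk' (axisRot θ) (axisRot_add θ)

lemma axisRot_sub (θ : ℝ) (x y : E3) : axisRot θ (x - y) = axisRot θ x - axisRot θ y :=
  map_sub (axisRotHom θ) x y

/-- Two horizontal vectors of the same length differ by a rotation about the vertical axis. -/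
lemma exists_eq_axisRot {x y : E3} (hx : x 2 = 0) (hy : y 2 = 0) (h : ‖x‖ = ‖y‖) :
    ∃ θ, x = axisRot θ y := by
  have hsq : x 0 ^ 2 + x 1 ^ 2 = y 0 ^ 2 + y 1 ^ 2 := by
    have h1 := norm_sq_eq_sum x
    have h2 := norm_sq_eq_sum y
    rw [h, hx] at h1
    rw [hy] at h2
    linarith
  set w : ℂ := ⟨x 0, x 1⟩ with hw
  set u : ℂ := ⟨y 0, y 1⟩ with hu
  have hnorm : ‖w‖ = ‖u‖ := by
    rw [← sq_eq_sq₀ (norm_nonneg _) (norm_nonneg _), ← Complex.normSq_eq_norm_sq,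
      ← Complex.normSq_eq_norm_sq, Complex.normSq_apply, Complex.normSq_apply]
    simp only [hw, hu]
    linarith
  obtain ⟨θ, hθ⟩ : ∃ θ : ℝ, w = Complex.exp (θ * Complex.I) * u := by
    rcases eq_or_ne u 0 with hu0 | hu0
    · exact ⟨0, by rw [hu0, mul_zero, ← norm_eq_zero, hnorm, hu0, norm_zero]⟩
    · refine ⟨Complex.arg (w / u), ?_⟩
      have h1 := Complex.norm_mul_exp_arg_mul_I (w / u)
      rw [norm_div, hnorm, div_self (norm_ne_zero_iff.2 hu0), Complex.ofReal_one, one_mul] at h1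
      rw [h1, div_mul_cancel₀ _ hu0]
  rw [Complex.exp_mul_I, ← Complex.ofReal_cos, ← Complex.ofReal_sin] at hθ
  refine ⟨θ, E3_ext ?_ ?_ (by simp [hx, hy])⟩
  · simpa [hw, hu, -Complex.ofReal_cos, -Complex.ofReal_sin] using congrArg Complex.re hθ
  · have := congrArg Complex.im hθ
    simp [hw, hu, -Complex.ofReal_cos, -Complex.ofReal_sin] at this
    rw [axisRot_apply_one]
    linarith

/-! ### Cylinders are null sets -/

/-- A cylinder lies in the frontier of the convex solid cylinder. -/
lemma volume_axisCylinder (ρ : ℝ) : volume (axisCylinder ρ) = 0 := by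
  set S : Set E3 := {x | x 0 ^ 2 + x 1 ^ 2 ≤ ρ ^ 2} with hS
  have hconv : Convex ℝ S := by
    intro x hx y hy a b ha hb hab
    obtain rfl : b = 1 - a := by linarith
    simp only [hS, mem_ofPred_eq, PiLp.add_apply, PiLp.smul_apply, smul_eq_mul] at hx hy ⊢
    nlinarith [mul_nonneg ha hb, mul_nonneg (mul_nonneg ha hb) (sq_nonneg (x 0 - y 0)),
      mul_nonneg (mul_nonneg ha hb) (sq_nonneg (x 1 - y 1)), mul_le_mul_of_nonneg_left hx ha,
      mul_le_mul_of_nonneg_left hy hb]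
  refine measure_mono_null (fun x hx => ?_) (hconv.addHaar_frontier volume)
  have hx' : x 0 ^ 2 + x 1 ^ 2 = ρ ^ 2 := by
    have h1 : Real.sqrt (x 0 ^ 2 + x 1 ^ 2) = ρ := hx
    rw [← h1, Real.sq_sqrt (by positivity)]
  refine ⟨subset_closure hx'.le, fun hint => ?_⟩
  -- moving away from the axis in the direction of `± e₀` leaves the solid cylinder at once
  obtain ⟨s, hs1, hs⟩ : ∃ s : ℝ, s ^ 2 = 1 ∧ 0 ≤ s * x 0 := by
    rcases le_total 0 (x 0) with h | h
    · exact ⟨1, by norm_num, by linarith⟩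
    · exact ⟨-1, by norm_num, by linarith⟩
  have hcont : Tendsto (fun t : ℝ => x + t • (!₂[s, 0, 0] : E3)) (𝓝 0) (𝓝 x) := by
    have : Continuous fun t : ℝ => x + t • (!₂[s, 0, 0] : E3) := by fun_prop
    simpa using this.tendsto 0
  have hev : ∀ᶠ t in 𝓝[>] (0 : ℝ), x + t • (!₂[s, 0, 0] : E3) ∈ S ∧ 0 < t :=
    ((hcont.eventually (mem_interior_iff_mem_nhds.1 hint)).filter_mono nhdsWithin_le_nhds).and
      self_mem_nhdsWithin
  obtain ⟨t, ht, ht0⟩ := hev.exists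
  have h1 : (x 0 + t * s) ^ 2 + x 1 ^ 2 ≤ ρ ^ 2 := by simpa [hS] using ht
  nlinarith [mul_nonneg ht0.le hs, mul_pos ht0 ht0]

namespace SCDTile

variable (P : SCDTile)

/-! ### The lattice and its dual -/

lemma sqrt_pos : 0 < Real.sqrt (P.b₁ ^ 2 + P.b₂ ^ 2) := by
  have := P.b₁_pos
  positivity

lemma vecA_mem : P.vecA ∈ P.lattice := AddSubgroup.subset_closure (by simp)

lemma vecB_mem : P.vecB ∈ P.lattice := AddSubgroup.subset_closure (by simp)

lemma apply_two_of_mem_lattice {x : E3} (hx : x ∈ P.lattice) : x 2 = 0 := by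
  obtain ⟨p, q, rfl⟩ := AddSubgroup.mem_closure_pair.1 hx
  simp [vecA, vecB]

/-- Nonzero lattice vectors have length at least `b₂`. -/
lemma b₂_le_norm {x : E3} (hx : x ∈ P.lattice) (h0 : x ≠ 0) : P.b₂ ≤ ‖x‖ := by
  obtain ⟨p, q, rfl⟩ := AddSubgroup.mem_closure_pair.1 hx
  have hint : ∀ n : ℤ, n ≠ 0 → (1 : ℝ) ≤ |(n : ℝ)| := fun n hn => by
    exact_mod_cast Int.one_le_abs hn
  by_cases hq : q = 0
  · have hp : p ≠ 0 := by
      rintro rfl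
      simp [hq] at h0
    refine le_trans ?_ (abs_apply_le_norm _ 0)
    have h1 : P.b₂ ≤ Real.sqrt (P.b₁ ^ 2 + P.b₂ ^ 2) :=
      Real.le_sqrt_of_sq_le (by linarith [sq_nonneg P.b₁])
    have h2 : (p • P.vecA + q • P.vecB) 0 = p * Real.sqrt (P.b₁ ^ 2 + P.b₂ ^ 2) := by
      simp [hq, vecA]
    rw [h2, abs_mul, abs_of_pos P.sqrt_pos]
    exact h1.trans (le_mul_of_one_le_left P.sqrt_pos.le (hint p hp))
  · refine le_trans ?_ (abs_apply_le_norm _ 1)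
    have h2 : (p • P.vecA + q • P.vecB) 1 = q * P.b₂ := by simp [vecA, vecB]
    rw [h2, abs_mul, abs_of_pos P.b₂_pos]
    exact le_mul_of_one_le_left P.b₂_pos.le (hint q hq)

lemma mem_dualLattice_iff {y : E3} : y ∈ P.dualLattice ↔ y 2 = 0 ∧
    (∃ k : ℤ, inner ℝ y P.vecA = (k : ℝ)) ∧ ∃ l : ℤ, inner ℝ y P.vecB = (l : ℝ) := by
  constructor
  · rintro ⟨h2, h⟩
    exact ⟨h2, h _ P.vecA_mem, h _ P.vecB_mem⟩
  · rintro ⟨h2, ⟨k, hk⟩, l, hl⟩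
    refine ⟨h2, fun x hx => ?_⟩
    obtain ⟨p, q, rfl⟩ := AddSubgroup.mem_closure_pair.1 hx
    refine ⟨p * k + q * l, ?_⟩
    rw [inner_add_right, ← Int.cast_smul_eq_zsmul ℝ p, ← Int.cast_smul_eq_zsmul ℝ q,
      real_inner_smul_right, real_inner_smul_right, hk, hl]
    push_cast
    rfl

lemma isClosed_dualLattice : IsClosed P.dualLattice := by
  have heq : P.dualLattice = {y : E3 | y 2 = 0} ∩
      ((fun y : E3 => inner ℝ y P.vecA) ⁻¹' range ((↑) : ℤ → ℝ) ∩
        (fun y : E3 => inner ℝ y P.vecB) ⁻¹' range ((↑) : ℤ → ℝ)) := by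
    ext y
    simp only [mem_dualLattice_iff, mem_inter_iff, mem_ofPred_eq, mem_preimage, mem_range, eq_comm]
  have hZ : IsClosed (range ((↑) : ℤ → ℝ)) := Int.isClosedEmbedding_coe_real.isClosed_range
  rw [heq]
  exact (isClosed_eq (by fun_prop) continuous_const).inter
    ((hZ.preimage (by fun_prop)).inter (hZ.preimage (by fun_prop)))

lemma countable_dualLattice : P.dualLattice.Countable := by
  have h : ∀ y ∈ P.dualLattice, ∃ p : ℤ × ℤ,
      inner ℝ y P.vecA = (p.1 : ℝ) ∧ inner ℝ y P.vecB = (p.2 : ℝ) := fun y hy => by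
    obtain ⟨-, ⟨k, hk⟩, l, hl⟩ := P.mem_dualLattice_iff.1 hy
    exact ⟨(k, l), hk, hl⟩
  choose! g hg using h
  refine MapsTo.countable_of_injOn (f := g) (t := univ) (fun _ _ => mem_univ _) ?_
    (to_countable _)
  intro x hx y hy hxy
  have hA := (hg x hx).1.trans ((congrArg (fun p : ℤ × ℤ => (p.1 : ℝ)) hxy).trans (hg y hy).1.symm)
  have hB := (hg x hx).2.trans ((congrArg (fun p : ℤ × ℤ => (p.2 : ℝ)) hxy).trans (hg y hy).2.symm)
  simp only [inner_eq_sum, vecA, vecB] at hA hB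
  simp at hA hB
  have h0 : x 0 = y 0 := hA.resolve_right P.sqrt_pos.ne'
  rw [h0, add_right_inj] at hB
  refine E3_ext h0 (mul_right_cancel₀ P.b₂_pos.ne' hB) ?_
  rw [hx.1, hy.1]

/-! ### The spectral set -/

lemma norm_rotPow (m : ℤ) (x : E3) : ‖P.rotPow m x‖ = ‖x‖ := norm_axisRot _ _

lemma rotPow_neg_rotPow (m : ℤ) (x : E3) : P.rotPow (-m) (P.rotPow m x) = x := by
  rw [rotPow, rotPow, axisRot_axisRot]
  have : ((-m : ℤ) : ℝ) * (-P.angle) + m * (-P.angle) = 0 := by push_cast; ring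
  rw [this, axisRot_zero_angle]

lemma rotPow_rotPow_neg (m : ℤ) (x : E3) : P.rotPow m (P.rotPow (-m) x) = x := by
  simpa using P.rotPow_neg_rotPow (-m) x

/-- The orthogonal projection to the horizontal plane. -/
noncomputable def horizontal (x : E3) : E3 := !₂[x 0, x 1, 0]

lemma continuous_horizontal : Continuous horizontal := by
  unfold horizontal
  refine (PiLp.continuous_toLp 2 _).comp (continuous_pi fun i => ?_)
  fin_cases i
  · change Continuous fun x : E3 => x 0
    fun_prop
  · change Continuous fun x : E3 => x 1
    fun_prop
  · exact continuous_const

lemma norm_horizontal (x : E3) : ‖horizontal x‖ = Real.sqrt (x 0 ^ 2 + x 1 ^ 2) := by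
  rw [eq_comm, Real.sqrt_eq_iff_eq_sq (by positivity) (norm_nonneg _), norm_sq_eq_sum]
  simp [horizontal]

lemma mem_spectralSet_iff {x : E3} : x ∈ P.spectralSet ↔
    horizontal x ∈ closure (⋃ m : ℤ, P.rotPow m '' P.dualLattice) := Iff.rfl

lemma isClosed_spectralSet : IsClosed P.spectralSet :=
  isClosed_closure.preimage continuous_horizontal

lemma horizontal_eq_iff {x y : E3} (hy : y 2 = 0) : horizontal x = y ↔ x ∈ verticalLine y := by
  constructor
  · rintro rfl
    exact ⟨rfl, rfl⟩
  · rintro ⟨h0, h1⟩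
    exact E3_ext h0 h1 hy.symm

/-- The norm is a proper map, so the lengths of the dual lattice vectors form a closed set. -/
lemma isClosed_norm_image_dualLattice : IsClosed (norm '' P.dualLattice) := by
  have : (norm : E3 → ℝ) = dist 0 := funext fun x => (dist_zero_left x).symm
  rw [this]
  exact isClosedMap_dist 0 _ P.isClosed_dualLattice

lemma spectralSet_subset_iUnion_axisCylinder :
    P.spectralSet ⊆ ⋃ y ∈ P.dualLattice, axisCylinder ‖y‖ := by
  intro x hx
  have h1 : ‖horizontal x‖ ∈ closure (norm '' P.dualLattice) := by
    refine map_mem_closure continuous_norm (P.mem_spectralSet_iff.1 hx) fun w hw => ?_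
    obtain ⟨m, y, hy, rfl⟩ := mem_iUnion.1 hw
    exact ⟨y, hy, (P.norm_rotPow m y).symm⟩
  rw [P.isClosed_norm_image_dualLattice.closure_eq] at h1
  obtain ⟨y, hy, hyx⟩ := h1
  exact mem_iUnion₂.2 ⟨y, hy, by
    rw [axisCylinder, mem_ofPred_eq, ← norm_horizontal]
    exact hyx.symm⟩

lemma volume_spectralSet : volume P.spectralSet = 0 :=
  measure_mono_null P.spectralSet_subset_iUnion_axisCylinder
    ((measure_biUnion_null_iff P.countable_dualLattice).2 fun y _ => volume_axisCylinder ‖y‖)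

/-- In the incommensurate case the rotations `R ^ m` are dense in the rotations about the axis. -/
lemma spectralSet_of_not_commensurate (h : ¬ P.Commensurate) :
    P.spectralSet = ⋃ y ∈ P.dualLattice, axisCylinder ‖y‖ := by
  refine P.spectralSet_subset_iUnion_axisCylinder.antisymm fun x hx => ?_
  obtain ⟨y, hy, hxy⟩ := mem_iUnion₂.1 hx
  have hirr : Irrational (-P.angle / (2 * Real.pi)) := by
    rintro ⟨q, hq⟩
    refine h ⟨-2 * q, ?_⟩
    have hpi := Real.pi_ne_zero
    rw [eq_div_iff (by positivity)] at hq
    push_cast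
    linarith
  have hdense : Dense (AddSubgroup.closure {-P.angle, 2 * Real.pi} : Set ℝ) :=
    dense_addSubgroupClosure_pair_iff.2 hirr
  obtain ⟨θ, hθ⟩ : ∃ θ, horizontal x = axisRot θ y := by
    have hx2 : horizontal x 2 = 0 := by simp [horizontal]
    have hy2 : y 2 = 0 := hy.1
    have hnorm : ‖horizontal x‖ = ‖y‖ := (norm_horizontal x).trans hxy
    exact exists_eq_axisRot hx2 hy2 hnorm
  rw [mem_spectralSet_iff, hθ]
  refine map_mem_closure (f := fun θ => axisRot θ y)
    (continuous_axisRot continuous_id continuous_const) (hdense θ) fun η hη => ?_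
  obtain ⟨m, k, rfl⟩ := AddSubgroup.mem_closure_pair.1 hη
  refine mem_iUnion.2 ⟨m, y, hy, ?_⟩
  simp only [zsmul_eq_mul]
  rw [axisRot_add_int_mul_two_pi]
  rfl

/-- In the commensurate case only finitely many of the rotations `R ^ m` are distinct. -/
lemma spectralSet_of_commensurate (h : P.Commensurate) :
    P.spectralSet = ⋃ m : ℤ, ⋃ y ∈ P.dualLattice, verticalLine (P.rotPow m y) := by
  obtain ⟨q, hq⟩ := h
  have hper : ∀ (m : ℤ) (y : E3), P.rotPow m y = P.rotPow (m % (2 * q.den)) y := fun m y => by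
    have hm : (m : ℝ) = (m % (2 * q.den) : ℤ) + 2 * q.den * (m / (2 * q.den) : ℤ) := by
      exact_mod_cast (Int.emod_add_mul_ediv m (2 * q.den)).symm
    have hden : (q.den : ℝ) * q = q.num := by exact_mod_cast Rat.den_mul_eq_num q
    have hangle : (m : ℝ) * (-P.angle) = (m % (2 * q.den) : ℤ) * (-P.angle) +
        ((-(m / (2 * q.den)) * q.num : ℤ) : ℝ) * (2 * Real.pi) := by
      rw [hm, hq]
      push_cast
      linear_combination (-2 * Real.pi * ((m / (2 * q.den) : ℤ) : ℝ)) * hden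
    rw [rotPow, hangle, axisRot_add_int_mul_two_pi]
    rfl
  have hfin : (⋃ m : ℤ, P.rotPow m '' P.dualLattice) =
      ⋃ m ∈ Finset.Ico (0 : ℤ) (2 * q.den), P.rotPow m '' P.dualLattice := by
    refine subset_antisymm (iUnion_subset fun m => ?_) (iUnion₂_subset fun m _ =>
      subset_iUnion (fun m => P.rotPow m '' P.dualLattice) m)
    rintro _ ⟨y, hy, rfl⟩
    have hpos : (0 : ℤ) < 2 * q.den := by have := q.den_pos; omega
    exact mem_iUnion₂.2 ⟨m % (2 * q.den), Finset.mem_Ico.2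
      ⟨Int.emod_nonneg _ hpos.ne', Int.emod_lt_of_pos _ hpos⟩, y, hy, (hper m y).symm⟩
  have hclosed : IsClosed (⋃ m : ℤ, P.rotPow m '' P.dualLattice) := by
    rw [hfin]
    refine isClosed_biUnion_finset fun m _ => ?_
    rw [image_eq_preimage_of_inverse (P.rotPow_neg_rotPow m) (P.rotPow_rotPow_neg m)]
    exact P.isClosed_dualLattice.preimage (continuous_axisRot continuous_const continuous_id)
  ext x
  rw [mem_spectralSet_iff, hclosed.closure_eq]
  simp only [mem_iUnion, mem_image, exists_prop]
  refine exists_congr fun m => exists_congr fun y => and_congr_right fun hy => ?_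
  rw [eq_comm, horizontal_eq_iff (by rw [rotPow, axisRot_apply_two, hy.1])]

/-- A frequency that is integral on both generators of a rotated lattice `R ^ m Γ` has its
horizontal part in `R ^ m Γ*`. -/
lemma mem_spectralSet_of_expSubOne {ξ : E3} {m : ℤ} (hA : expSubOne (P.rotPow m P.vecA) ξ = 0)
    (hB : expSubOne (P.rotPow m P.vecB) ξ = 0) : ξ ∈ P.spectralSet := by
  refine subset_closure (mem_iUnion.2 ⟨m, P.rotPow (-m) (horizontal ξ), ?_,
    P.rotPow_rotPow_neg m _⟩)
  have key : ∀ x : E3, x 2 = 0 →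
      inner ℝ (P.rotPow (-m) (horizontal ξ)) x = inner ℝ ξ (P.rotPow m x) := fun x hx => by
    have : ((-m : ℤ) : ℝ) * -P.angle = -(m * -P.angle) := by push_cast; ring
    rw [rotPow, rotPow, this, ← inner_axisRot_right]
    simp [inner_eq_sum, horizontal, hx]
  rw [mem_dualLattice_iff, key _ (by simp [vecA]), key _ (by simp [vecB])]
  exact ⟨by simp [rotPow, horizontal], expSubOne_eq_zero_iff.1 hA, expSubOne_eq_zero_iff.1 hB⟩

end SCDTile

/-! ### The points of an SCD set -/

namespace SCDTiling

variable {P : SCDTile} (𝒯 : SCDTiling P) (z : E3)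

/-- The reference point of a tile, by the number of its layer and its lattice vector. -/
noncomputable def point (q : ℤ × P.lattice) : E3 := 𝒯.pos q.1 q.2 + P.rotPow q.1 z

lemma range_point : range (𝒯.point z) = 𝒯.pointSet z := by
  ext p
  constructor
  · rintro ⟨⟨m, x⟩, rfl⟩
    exact ⟨m, x, x.2, rfl⟩
  · rintro ⟨m, x, hx, rfl⟩
    exact ⟨(m, ⟨x, hx⟩), rfl⟩

/-- Points of different layers differ in height by at least `c`, and those of one layer by the
rotation of a lattice vector. -/
lemma min_le_dist_point {q q' : ℤ × P.lattice} (h : q ≠ q') :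
    min P.c P.b₂ ≤ dist (𝒯.point z q) (𝒯.point z q') := by
  obtain ⟨m, x⟩ := q
  obtain ⟨m', x'⟩ := q'
  rw [dist_eq_norm]
  by_cases hm : m = m'
  · subst hm
    have hxx : (x : E3) - x' ≠ 0 := by
      rw [sub_ne_zero]
      rintro hx
      exact h (by rw [Subtype.ext hx])
    have heq : 𝒯.point z (m, x) - 𝒯.point z (m, x') = P.rotPow m ((x : E3) - x') := by
      simp only [point, pos, SCDTile.rotPow, axisRot_sub]
      abel
    rw [heq, P.norm_rotPow]
    exact (min_le_right _ _).trans (P.b₂_le_norm (P.lattice.sub_mem x.2 x'.2) hxx)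
  · refine (min_le_left _ _).trans (le_trans ?_ (abs_apply_le_norm _ 2))
    have hz : ∀ (m : ℤ) (x : P.lattice), 𝒯.point z (m, x) 2 = m * P.c - P.c + z 2 :=
      fun m x => by
        have h1 := 𝒯.v_horizontal m
        have h2 := P.apply_two_of_mem_lattice x.2
        simp only [point, pos, SCDTile.rotPow, SCDTile.vecC, SCDTile.vecB, SCDTile.vert,
          PiLp.add_apply, PiLp.sub_apply, PiLp.smul_apply, axisRot_apply_two, h1, h2]
        simp
        ring
    rw [PiLp.sub_apply, hz, hz]
    have h1 : (1 : ℝ) ≤ |((m - m' : ℤ) : ℝ)| := by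
      exact_mod_cast Int.one_le_abs (sub_ne_zero.2 hm)
    have h2 : (m : ℝ) * P.c - P.c + z 2 - (m' * P.c - P.c + z 2) = ((m - m' : ℤ) : ℝ) * P.c := by
      push_cast
      ring
    rw [h2, abs_mul, abs_of_pos P.c_pos]
    exact le_mul_of_one_le_left P.c_pos.le h1

lemma point_injective : Function.Injective (𝒯.point z) := fun q q' h => by
  by_contra hne
  have := 𝒯.min_le_dist_point z hne
  rw [h, dist_self] at this
  exact absurd this (not_le.2 (lt_min P.c_pos P.b₂_pos))

lemma uniformlyDiscrete_pointSet : UniformlyDiscrete (𝒯.pointSet z) := by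
  refine ⟨min P.c P.b₂, lt_min P.c_pos P.b₂_pos, ?_⟩
  rw [← range_point]
  rintro _ ⟨q, rfl⟩ _ ⟨q', rfl⟩ h
  exact 𝒯.min_le_dist_point z fun hq => h (by rw [hq])

lemma summable_schwartz_point (g : 𝓢(E3, ℂ)) (u : E3) :
    Summable fun q => g (𝒯.point z q - u) := by
  have h := (𝒯.uniformlyDiscrete_pointSet z).summable_schwartz g u
  rw [← 𝒯.range_point z] at h
  have hi := (Equiv.ofInjective _ (𝒯.point_injective z)).injective
  have h2 := h.comp_injective hi
  refine h2.congr fun q => ?_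
  rw [Function.comp_apply, Equiv.ofInjective_apply]

/-- Each layer is a translate of a rotated lattice, so the sum of `𝓕 f` over it vanishes when the
support of `f` avoids the spectral set. -/
lemma tsum_fourier_pointSet {f : 𝓢(E3, ℂ)} (hc : HasCompactSupport f)
    (hf : tsupport f ⊆ (P.spectralSet)ᶜ) (u : E3) :
    ∑' x : 𝒯.pointSet z, 𝓕 f ((x : E3) - u) = 0 := by
  rw [← 𝒯.range_point z, tsum_range (fun x => 𝓕 f (x - u)) (𝒯.point_injective z),
    (𝒯.summable_schwartz_point z (𝓕 f) u).tsum_prod]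
  refine (tsum_congr fun m => ?_).trans tsum_zero
  let φ : P.lattice →+ E3 := (axisRotHom (m * (-P.angle))).comp P.lattice.subtype
  let t : E3 := (m : ℝ) • P.vert + 𝒯.v m - P.rotPow m P.vecC + P.rotPow m z
  have hφ : ∀ (x : P.lattice) (w : E3), 𝒯.point z (m, x) - w = φ x + (t - w) := fun x w => by
    change (m : ℝ) • P.vert + 𝒯.v m + P.rotPow m (x - P.vecC) + P.rotPow m z - w =
      P.rotPow m x + ((m : ℝ) • P.vert + 𝒯.v m - P.rotPow m P.vecC + P.rotPow m z - w)
    simp only [SCDTile.rotPow, axisRot_sub]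
    abel
  simp_rw [hφ]
  refine tsum_fourier_eq_zero φ (fun g w => ?_) ⟨_, P.vecA_mem⟩ ⟨_, P.vecB_mem⟩ (f.smooth ⊤) hc
    (fun ξ hξ h0 => hf hξ (P.mem_spectralSet_of_expSubOne h0.1 h0.2)) (t - u)
  have := (𝒯.summable_schwartz_point z g (t - w)).prod_factor m
  simpa only [hφ, sub_sub_cancel] using this

/-- The Fourier transform of an autocorrelation does not charge the complement of the spectral
set. -/
lemma measure_compl_spectralSet {γ μ : Measure E3} (hγ : IsAutocorrelation (𝒯.pointSet z) γ)
    (hμ : IsFourierTransform γ μ) : μ (P.spectralSet)ᶜ = 0 := by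
  have := hγ.1
  have := hμ.1
  have hΛ := 𝒯.uniformlyDiscrete_pointSet z
  obtain ⟨r, hr, hrt, hv⟩ := UniformlyDiscrete.exists_radii hγ
  refine measure_eq_zero_of_forall_smooth P.isClosed_spectralSet.isOpen_compl
    fun f hf hc hsupp => ?_
  set F : 𝓢(E3, ℂ) := toSchwartz hf hc with hF
  have hFc : HasCompactSupport F := hc.comp_left (g := fun t : ℝ => (t : ℂ)) Complex.ofReal_zero
  have hFs : tsupport F ⊆ (P.spectralSet)ᶜ :=
    (closure_mono (Function.support_comp_subset (g := fun t : ℝ => (t : ℂ))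
      Complex.ofReal_zero f)).trans hsupp
  obtain ⟨K, hK, hFK⟩ := (𝓕 F).exists_norm_le_weight 1
  simp only [pow_one] at hFK
  have h0 := (hΛ.tendsto_sum_patch_zero hK hFK (𝒯.tsum_fourier_pointSet z hFc hFs)).comp hrt
  have h1 := (hΛ.integral_schwartz_of_isAutocorrelation hr hv (𝓕 F)).2
  have h2 : ∫ x, (f x : ℂ) ∂μ = 0 := ((hμ.2 F).2.2).trans (tendsto_nhds_unique h1 h0)
  rw [integral_complex_ofReal] at h2
  exact_mod_cast h2

end SCDTiling

theorem theorem1 (P : SCDTile) (𝒯 : SCDTiling P) (z : E3) (hz : z ∈ interior P.prototile) :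
    (∀ γ : Measure E3, IsAutocorrelation (𝒯.pointSet z) γ →
      (∃! μ : Measure E3, IsFourierTransform γ μ) ∧
      ∀ μ : Measure E3, IsFourierTransform γ μ →
        μ ⟂ₘ (volume : Measure E3) ∧ μ (P.spectralSet)ᶜ = 0) ∧
    (¬ P.Commensurate → P.spectralSet = ⋃ y ∈ P.dualLattice, axisCylinder ‖y‖) ∧
    (P.Commensurate →
      P.spectralSet = ⋃ m : ℤ, ⋃ y ∈ P.dualLattice, verticalLine (P.rotPow m y)) := by
  refine ⟨fun γ hγ => ⟨?_, fun μ hμ => ?_⟩, P.spectralSet_of_not_commensurate,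
    P.spectralSet_of_commensurate⟩
  · obtain ⟨μ, hμ⟩ := (𝒯.uniformlyDiscrete_pointSet z).exists_isFourierTransform hγ
    refine ⟨μ, hμ, fun ν hν => ?_⟩
    have := hμ.1
    have := hν.1
    exact measure_eq_of_forall_schwartz fun f => (hν.2 f).2.2.trans (hμ.2 f).2.2.symm
  · have h := 𝒯.measure_compl_spectralSet z hγ hμ
    refine ⟨⟨(P.spectralSet)ᶜ, P.isClosed_spectralSet.isOpen_compl.measurableSet, h, ?_⟩, h⟩
    rw [compl_compl]
    exact P.volume_spectralSet
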